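/- Let $N$ be a non-negative integer, let $A$ and $B$ be arbitrary complex $N\times N$ matrices, and let $\lambda$ be a partition with at most $N$ nonzero parts. For a complex $N\times N$ matrix $X$ let $s_\lambda(X)$ denote the Schur polynomial $s_\lambda(x_1,\dots,x_N)=\det\bigl(h_{\lambda_i-i+j}(x_1,\dots,x_N)\bigr)_{1\le i,j\le \ell(\lambda)}$ evaluated at the eigenvalues $x_1,\dots,x_N$ of $X$, counted with algebraic multiplicity; here $h_k$ is the complete homogeneous symmetric polynomial of degree $k$, $h_k=0$ for $k<0$, and $\ell(\lambda)$ is the number of nonzero parts of $\lambda$. Let $d_*U$ be the Haar measure on the unitary group $\mathbb U_N$, normalized so that $\int_{\mathbb U_N}d_*U=1$. Then $s_\lambda(I_N)\neq 0$, the function $U\mapsto s_\lambda(UAU^\dagger B)$ is integrable on $\mathbb U_N$, and $$\int_{\mathbb U_N}s_\lambda(UAU^\dagger B)\,d_*U=\frac{s_\lambda(A)\,s_\lambda(B)}{s_\lambda(I_N)}.$$ -/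

import Mathlib

open MeasureTheory Matrix

/-- The Schur polynomial `s_λ` in the variables indexed by a finite type `σ`, for a partition `λ`
(a Young diagram whose `i`-th row has length `λ_i`): the Jacobi–Trudi determinant
`det (h_{λ_i - i + j})`, `i, j` running over the rows of `λ`, where `h_k` is the `k`-th complete
homogeneous symmetric polynomial, with `h_k = 0` for `k < 0`. -/
noncomputable def schurPolynomial (σ R : Type*) [Fintype σ] [DecidableEq σ] [CommRing R]
    (lam : YoungDiagram) : MvPolynomial σ R :=
  Matrix.det (Matrix.of fun i j : Fin (lam.colLen 0) =>
    if (i : ℕ) ≤ lam.rowLen i + j then MvPolynomial.hsymm σ R (lam.rowLen i + j - i) else 0)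

open Classical in
/-- The Schur function `s_λ(A)` of a complex square matrix `A`: the Schur polynomial evaluated at
the eigenvalues of `A`, counted with algebraic multiplicity. The variables are indexed by the
multiset of roots of the characteristic polynomial. -/
noncomputable def matrixSchur {N : ℕ} (lam : YoungDiagram) (A : Matrix (Fin N) (Fin N) ℂ) : ℂ :=
  MvPolynomial.eval (fun x : A.charpoly.roots.ToType => x.1)
    (schurPolynomial A.charpoly.roots.ToType ℂ lam)

/-!
The function `minorPower a`, the product of the powers `Δₖ ^ aₖ` of the leading principal minors, is
multiplicative for lower triangular factors on the left and upper triangular factors on the right.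
This is the behaviour of the diagonal matrix coefficient at a highest weight vector of weight
`minorWeight a`, and since almost every matrix is a product of such factors it determines the
function up to a scalar. The representation itself is never constructed. Its normalized character
is replaced by the average `sphericalFunction μ a X = ∫ minorPower a (U X U†)`.

*Product formula.* The average of `U A U†` commutes with every unitary matrix; this is an identity
between polynomials, so it holds for every matrix, because the unitary group is Zariski dense
(`IsPolyFunction.ext_unitary`, `integral_conj_mul_comm`). Hence `Y ↦ ∫ minorPower a (U A U† Y)` again
transforms under triangular matrices as `minorPower a` does, and is a multiple of it
(`integral_minorPower_conj_mul`, the substitute for Schur's lemma). Averaging over conjugation of `Y`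
gives `∫ φ(U A U† B) = φ(A) φ(B)` for a spherical function `φ`
(`integral_sphericalFunction_conj_mul`).

It remains to see that `s_λ` is a nonzero multiple of the spherical function of weight `λ`; the
multiple is then `s_λ(I)`, because spherical functions are `1` at the identity. Restricted to diagonal
matrices the spherical functions are symmetric polynomials with leading monomials
`x ^ minorWeight a`, so they span (`mem_span_sphericalPolynomial`). Two triangularity statements leave
only one term in the expansion of `s_λ`:

* every weight that occurs dominates `λ` (`lex_le_of_coeff_ne_zero`). By orthogonality the coefficients
  are integrals of `s_λ(U†)` against `minorPower c`; the Jacobi–Trudi determinant is a combination of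
  products of complete homogeneous polynomials `h_α` with `α` dominating `λ`; these are traces on
  tensor products of symmetric powers, and a highest weight there dominates `α`
  (`integral_columnMonomial_eq_zero`);
* the leading monomial of `s_λ` is `x ^ λ`, by the bialternant formula (`degree_det_jacobiTrudi`), so no
  weight above `λ` occurs.
-/

/-! ### Polynomial functions on matrices and their averages -/

/-- A polynomial function of the entries of a complex square matrix. -/
def IsPolyFunction {N : ℕ} (f : Matrix (Fin N) (Fin N) ℂ → ℂ) : Prop :=
  ∃ P : MvPolynomial (Fin N × Fin N) ℂ, ∀ X, f X = MvPolynomial.eval (fun p => X p.1 p.2) P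

/-- A family of polynomial functions on matrices whose coefficients are continuous in a parameter
`ω`, encoded as a polynomial over the ring `C(Ω, ℂ)`. -/
def IsPolyFamily {N : ℕ} {Ω : Type*} [TopologicalSpace Ω]
    (F : Ω → Matrix (Fin N) (Fin N) ℂ → ℂ) : Prop :=
  ∃ P : MvPolynomial (Fin N × Fin N) C(Ω, ℂ), ∀ ω X, F ω X =
    MvPolynomial.eval₂ ((Pi.evalRingHom (fun _ : Ω => ℂ) ω).comp ContinuousMap.coeFnRingHom)
      (fun p => X p.1 p.2) P

/-- A family of matrices whose entries are polynomial families. -/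
def IsPolyMatrixFamily {N : ℕ} {Ω : Type*} [TopologicalSpace Ω]
    (M : Ω → Matrix (Fin N) (Fin N) ℂ → Matrix (Fin N) (Fin N) ℂ) : Prop :=
  ∀ i j, IsPolyFamily fun ω X => M ω X i j

section PolyFamily

variable {N : ℕ} {Ω : Type*} [TopologicalSpace Ω]

theorem IsPolyFamily.const {c : Ω → ℂ} (hc : Continuous c) :
    IsPolyFamily (N := N) fun ω _ => c ω :=
  ⟨MvPolynomial.C ⟨c, hc⟩, fun ω X => by rw [MvPolynomial.eval₂_C]; rfl⟩

theorem IsPolyFamily.coord (i j : Fin N) :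
    IsPolyFamily fun (_ : Ω) (X : Matrix (Fin N) (Fin N) ℂ) => X i j :=
  ⟨MvPolynomial.X (i, j), fun ω X => by simp⟩

theorem IsPolyFamily.add {F F' : Ω → Matrix (Fin N) (Fin N) ℂ → ℂ} (hF : IsPolyFamily F)
    (hF' : IsPolyFamily F') : IsPolyFamily fun ω X => F ω X + F' ω X := by
  obtain ⟨P, hP⟩ := hF
  obtain ⟨P', hP'⟩ := hF'
  exact ⟨P + P', fun ω X => by simp only [hP, hP', MvPolynomial.eval₂_add]⟩

theorem IsPolyFamily.mul {F F' : Ω → Matrix (Fin N) (Fin N) ℂ → ℂ} (hF : IsPolyFamily F)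
    (hF' : IsPolyFamily F') : IsPolyFamily fun ω X => F ω X * F' ω X := by
  obtain ⟨P, hP⟩ := hF
  obtain ⟨P', hP'⟩ := hF'
  exact ⟨P * P', fun ω X => by simp only [hP, hP', MvPolynomial.eval₂_mul]⟩

theorem IsPolyFamily.sum {ι : Type*} (s : Finset ι) {F : ι → Ω → Matrix (Fin N) (Fin N) ℂ → ℂ}
    (hF : ∀ i, IsPolyFamily (F i)) : IsPolyFamily fun ω X => ∑ i ∈ s, F i ω X := by
  choose P hP using hF
  exact ⟨∑ i ∈ s, P i, fun ω X => by simp only [hP, MvPolynomial.eval₂_sum]⟩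

theorem IsPolyMatrixFamily.const {c : Ω → Matrix (Fin N) (Fin N) ℂ} (hc : Continuous c) :
    IsPolyMatrixFamily fun ω _ => c ω :=
  fun i j => IsPolyFamily.const (hc.matrix_elem i j)

theorem IsPolyMatrixFamily.id :
    IsPolyMatrixFamily fun (_ : Ω) (X : Matrix (Fin N) (Fin N) ℂ) => X :=
  fun i j => IsPolyFamily.coord i j

theorem IsPolyMatrixFamily.mul {M M' : Ω → Matrix (Fin N) (Fin N) ℂ → Matrix (Fin N) (Fin N) ℂ}
    (hM : IsPolyMatrixFamily M) (hM' : IsPolyMatrixFamily M') :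
    IsPolyMatrixFamily fun ω X => M ω X * M' ω X := by
  intro i j
  simp only [Matrix.mul_apply]
  exact IsPolyFamily.sum _ fun k => (hM i k).mul (hM' k j)

theorem IsPolyFunction.comp {f : Matrix (Fin N) (Fin N) ℂ → ℂ} (hf : IsPolyFunction f)
    {M : Ω → Matrix (Fin N) (Fin N) ℂ → Matrix (Fin N) (Fin N) ℂ} (hM : IsPolyMatrixFamily M) :
    IsPolyFamily fun ω X => f (M ω X) := by
  obtain ⟨P, hP⟩ := hf
  simp only [hP]
  clear hP
  induction P using MvPolynomial.induction_on with
  | C c => simpa using IsPolyFamily.const (N := N) (Ω := Ω) (continuous_const (y := c))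
  | add P Q hP hQ => simpa using hP.add hQ
  | mul_X P i hP => simpa using hP.mul (hM i.1 i.2)

/-- A polynomial family over a one-point parameter space is a polynomial function. -/
theorem IsPolyFamily.isPolyFunction {F : Unit → Matrix (Fin N) (Fin N) ℂ → ℂ}
    (hF : IsPolyFamily F) : IsPolyFunction (F ()) := by
  obtain ⟨P, hP⟩ := hF
  refine ⟨P.map ((Pi.evalRingHom (fun _ : Unit => ℂ) ()).comp ContinuousMap.coeFnRingHom),
    fun X => ?_⟩
  rw [MvPolynomial.eval_map]
  exact hP () X

theorem IsPolyFunction.continuous {f : Matrix (Fin N) (Fin N) ℂ → ℂ} (hf : IsPolyFunction f) :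
    Continuous f := by
  obtain ⟨P, hP⟩ := hf
  have : f = fun X => MvPolynomial.eval (fun p => X p.1 p.2) P := funext hP
  rw [this]
  exact (MvPolynomial.continuous_eval P).comp
    (continuous_pi fun p => continuous_id.matrix_elem p.1 p.2)

/-- The coefficientwise integral of a polynomial with continuous coefficients. -/
noncomputable def integralCoeff {τ : Type*} [MeasurableSpace Ω] (μ : Measure Ω)
    (P : MvPolynomial τ C(Ω, ℂ)) : MvPolynomial τ ℂ :=
  ∑ m ∈ P.support, MvPolynomial.monomial m (∫ ω, P.coeff m ω ∂μ)

theorem coeff_integralCoeff {τ : Type*} [MeasurableSpace Ω] (μ : Measure Ω)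
    (P : MvPolynomial τ C(Ω, ℂ)) (m : τ →₀ ℕ) :
    (integralCoeff μ P).coeff m = ∫ ω, P.coeff m ω ∂μ := by
  classical
  rw [integralCoeff, MvPolynomial.coeff_sum]
  simp only [MvPolynomial.coeff_monomial]
  rw [Finset.sum_ite_eq']
  split_ifs with h
  · rfl
  · simp [MvPolynomial.notMem_support_iff.mp h]

theorem eval_integralCoeff {τ : Type*} [CompactSpace Ω] [MeasurableSpace Ω] [BorelSpace Ω]
    (μ : Measure Ω) [IsFiniteMeasure μ] (P : MvPolynomial τ C(Ω, ℂ)) (x : τ → ℂ) :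
    MvPolynomial.eval x (integralCoeff μ P) = ∫ ω, MvPolynomial.eval₂
      ((Pi.evalRingHom (fun _ : Ω => ℂ) ω).comp ContinuousMap.coeFnRingHom) x P ∂μ := by
  simp only [MvPolynomial.eval₂_eq, integralCoeff, map_sum, MvPolynomial.eval_monomial]
  rw [integral_finsetSum]
  · refine Finset.sum_congr rfl fun m _ => ?_
    rw [integral_mul_const]
    rfl
  · intro m _
    refine Integrable.mul_const ?_ _
    exact (P.coeff m).continuous.integrable_of_hasCompactSupport
      (HasCompactSupport.of_compactSpace _)

theorem IsPolyFamily.integral [CompactSpace Ω] [MeasurableSpace Ω] [BorelSpace Ω]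
    (μ : Measure Ω) [IsFiniteMeasure μ] {F : Ω → Matrix (Fin N) (Fin N) ℂ → ℂ}
    (hF : IsPolyFamily F) : IsPolyFunction fun X => ∫ ω, F ω X ∂μ := by
  obtain ⟨P, hP⟩ := hF
  refine ⟨integralCoeff μ P, fun X => ?_⟩
  rw [eval_integralCoeff]
  simp only [hP]

end PolyFamily

/-! ### Zariski density of the unitary group -/

section Density

variable {N : ℕ}

theorem eval_aeval {σ τ : Type*} (x : τ → ℂ) (H : σ → MvPolynomial τ ℂ) (R : MvPolynomial σ ℂ) :
    MvPolynomial.eval x (MvPolynomial.aeval H R) =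
      MvPolynomial.eval (fun p => MvPolynomial.eval x (H p)) R := by
  induction R using MvPolynomial.induction_on with
  | C c => simp
  | add P Q hP hQ => rw [map_add, map_add, map_add, hP, hQ]
  | mul_X P i hP => rw [map_mul, map_mul, map_mul, hP, MvPolynomial.aeval_X, MvPolynomial.eval_X]

/-- Hermitian matrices are Zariski dense: every complex matrix is `a + aᵀ + i (a - aᵀ)` for a
complex matrix `a`, and this is Hermitian when `a` is real. -/
theorem IsPolyFunction.ext_isHermitian {f g : Matrix (Fin N) (Fin N) ℂ → ℂ}
    (hf : IsPolyFunction f) (hg : IsPolyFunction g)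
    (h : ∀ X : Matrix (Fin N) (Fin N) ℂ, X.IsHermitian → f X = g X) : f = g := by
  obtain ⟨P, hP⟩ := hf
  obtain ⟨Q, hQ⟩ := hg
  let H : Fin N × Fin N → MvPolynomial (Fin N × Fin N) ℂ := fun p =>
    MvPolynomial.X p + MvPolynomial.X p.swap +
      MvPolynomial.C Complex.I * (MvPolynomial.X p - MvPolynomial.X p.swap)
  have key : MvPolynomial.aeval H P = MvPolynomial.aeval H Q := by
    refine MvPolynomial.funext_set (fun _ => Set.range ((↑) : ℝ → ℂ))
      (fun _ => Set.infinite_range_of_injective Complex.ofReal_injective) fun x hx => ?_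
    have hx' : ∀ p, star (x p) = x p := by
      intro p
      obtain ⟨r, hr⟩ := hx p (Set.mem_univ p)
      rw [← hr]
      exact Complex.conj_ofReal r
    have := h (Matrix.of fun i j => MvPolynomial.eval x (H (i, j))) (by
      ext i j
      simp only [H, Matrix.conjTranspose_apply, Matrix.of_apply, map_add, map_mul, map_sub,
        MvPolynomial.eval_X, MvPolynomial.eval_C, star_add, star_mul', star_sub, hx']
      simp
      ring)
    rw [hP, hQ] at this
    rw [eval_aeval, eval_aeval]
    exact this
  funext X
  let a : Fin N × Fin N → ℂ := fun p =>
    (X p.1 p.2 + X p.2 p.1) / 4 + (X p.1 p.2 - X p.2 p.1) / (4 * Complex.I)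
  have ha : (fun p : Fin N × Fin N => MvPolynomial.eval a (H p)) = fun p => X p.1 p.2 := by
    funext p
    simp only [H, a, map_add, map_mul, map_sub, MvPolynomial.eval_X, MvPolynomial.eval_C,
      Prod.fst_swap, Prod.snd_swap]
    field_simp
    ring_nf
  have key' := congrArg (MvPolynomial.eval a) key
  rw [eval_aeval, eval_aeval, ha] at key'
  rw [hP, hQ, key']

/-- A polynomial function on matrices is determined by its values on the matrices
`U * diagonal d * U†` with `U` unitary, by the spectral theorem. -/
theorem IsPolyFunction.ext_conj_diagonal {f g : Matrix (Fin N) (Fin N) ℂ → ℂ}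
    (hf : IsPolyFunction f) (hg : IsPolyFunction g)
    (h : ∀ (U : Matrix.unitaryGroup (Fin N) ℂ) (d : Fin N → ℂ),
      f (U * Matrix.diagonal d * (U : Matrix (Fin N) (Fin N) ℂ)ᴴ) =
        g (U * Matrix.diagonal d * (U : Matrix (Fin N) (Fin N) ℂ)ᴴ)) : f = g := by
  refine hf.ext_isHermitian hg fun X hX => ?_
  have := hX.spectral_theorem
  rw [Unitary.conjStarAlgAut_apply] at this
  rw [this]
  exact h _ _

/-- The unitary group is Zariski dense in the space of all matrices. -/
theorem IsPolyFunction.ext_unitary {f g : Matrix (Fin N) (Fin N) ℂ → ℂ}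
    (hf : IsPolyFunction f) (hg : IsPolyFunction g)
    (h : ∀ U : Matrix.unitaryGroup (Fin N) ℂ, f U = g U) : f = g := by
  refine hf.ext_conj_diagonal hg fun U d => ?_
  obtain ⟨P, hP⟩ := hf
  obtain ⟨Q, hQ⟩ := hg
  -- For fixed `U` both sides are polynomials in `d` that agree on the torus `|d_i| = 1`.
  let H : Fin N × Fin N → MvPolynomial (Fin N) ℂ := fun p =>
    ∑ k, MvPolynomial.C ((U : Matrix (Fin N) (Fin N) ℂ) p.1 k *
      star ((U : Matrix (Fin N) (Fin N) ℂ) p.2 k)) * MvPolynomial.X k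
  have hH : ∀ (e : Fin N → ℂ) (R : MvPolynomial (Fin N × Fin N) ℂ),
      MvPolynomial.eval e (MvPolynomial.aeval H R) = MvPolynomial.eval (fun p =>
        (U * Matrix.diagonal e * (U : Matrix (Fin N) (Fin N) ℂ)ᴴ) p.1 p.2) R := by
    intro e R
    have : (fun p : Fin N × Fin N => MvPolynomial.eval e (H p)) = fun p =>
        ((U : Matrix (Fin N) (Fin N) ℂ) * Matrix.diagonal e *
          (U : Matrix (Fin N) (Fin N) ℂ)ᴴ) p.1 p.2 := by
      funext p
      rw [Matrix.mul_apply]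
      simp only [H, map_sum, map_mul, MvPolynomial.eval_C, MvPolynomial.eval_X,
        Matrix.mul_diagonal, Matrix.conjTranspose_apply]
      exact Finset.sum_congr rfl fun k _ => by ring
    rw [← this, eval_aeval]
  have key : MvPolynomial.aeval H P = MvPolynomial.aeval H Q := by
    refine MvPolynomial.funext_set (fun _ => {z : ℂ | ‖z‖ = 1}) (fun _ => ?_) fun x hx => ?_
    · refine ((Set.Ioc_infinite (neg_lt_self Real.pi_pos)).image
        (f := fun t : ℝ => Complex.exp (t * Complex.I)) ?_).mono ?_
      · intro s hs t ht hst
        have := congrArg Complex.arg hst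
        simp only [Complex.arg_exp_mul_I] at this
        rwa [(toIocMod_eq_self _).2 (by convert hs using 1; ring_nf),
          (toIocMod_eq_self _).2 (by convert ht using 1; ring_nf)] at this
      · rintro _ ⟨t, -, rfl⟩
        exact Complex.norm_exp_ofReal_mul_I _
    · rw [hH, hH, ← hP, ← hQ]
      have hd : Matrix.diagonal x ∈ Matrix.unitaryGroup (Fin N) ℂ := by
        rw [Matrix.mem_unitaryGroup_iff, Matrix.star_eq_conjTranspose,
          Matrix.diagonal_conjTranspose, Matrix.diagonal_mul_diagonal, ← Matrix.diagonal_one]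
        congr 1
        funext i
        have : ‖x i‖ = 1 := hx i (Set.mem_univ i)
        simp [Complex.mul_conj, Complex.normSq_eq_norm_sq, this]
      have := h (U * ⟨_, hd⟩ * star U)
      rwa [Submonoid.coe_mul, Submonoid.coe_mul, Unitary.coe_star,
        Matrix.star_eq_conjTranspose] at this
  rw [hP, hQ, ← hH, ← hH, key]

end Density

/-! ### Haar measure on the unitary group -/

section Haar

variable {N : ℕ}

instance compactSpace_unitaryGroup : CompactSpace (Matrix.unitaryGroup (Fin N) ℂ) := by
  refine isCompact_iff_compactSpace.mp ?_
  refine IsCompact.of_isClosed_subset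
    (s := Set.pi Set.univ fun _ : Fin N => Set.pi Set.univ fun _ : Fin N =>
      Metric.closedBall (0 : ℂ) 1)
    (isCompact_univ_pi fun _ => isCompact_univ_pi fun _ => isCompact_closedBall _ _) ?_ ?_
  · have : ((Matrix.unitaryGroup (Fin N) ℂ : Submonoid _) : Set (Matrix (Fin N) (Fin N) ℂ)) =
        {A | A * star A = 1} := by
      ext A
      exact Matrix.mem_unitaryGroup_iff
    rw [this]
    exact isClosed_eq (by fun_prop) continuous_const
  · intro A hA i _ j _
    simpa using entry_norm_bound_of_unitary hA i j

variable [MeasurableSpace (Matrix.unitaryGroup (Fin N) ℂ)]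
  [BorelSpace (Matrix.unitaryGroup (Fin N) ℂ)]
  (μ : Measure (Matrix.unitaryGroup (Fin N) ℂ)) [μ.IsHaarMeasure]

/-- A normalized Haar measure on a compact group is right invariant, by uniqueness. -/
instance isMulRightInvariant_unitaryGroup [IsProbabilityMeasure μ] : μ.IsMulRightInvariant where
  map_mul_right_eq_self g := by
    have : IsProbabilityMeasure (Measure.map (· * g) μ) :=
      Measure.isProbabilityMeasure_map (by fun_prop)
    exact Measure.isHaarMeasure_eq_of_isProbabilityMeasure _ _

variable {μ}

theorem integrable_of_continuous {f : Matrix.unitaryGroup (Fin N) ℂ → ℂ} (hf : Continuous f) :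
    Integrable f μ :=
  hf.integrable_of_hasCompactSupport (HasCompactSupport.of_compactSpace _)

theorem integral_swap_of_continuous
    {f : Matrix.unitaryGroup (Fin N) ℂ → Matrix.unitaryGroup (Fin N) ℂ → ℂ}
    (hf : Continuous (Function.uncurry f)) :
    ∫ U, ∫ V, f U V ∂μ ∂μ = ∫ V, ∫ U, f U V ∂μ ∂μ :=
  integral_integral_swap_of_hasCompactSupport hf (HasCompactSupport.of_compactSpace _)

end Haar

/-! ### Products of powers of leading principal minors -/

section Minors

variable {N : ℕ} {R : Type*} [CommRing R]

/-- The leading principal minor of `X` on the rows and columns `i ≤ k`. -/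
def leadingMinor (X : Matrix (Fin N) (Fin N) R) (k : Fin N) : R :=
  (X.submatrix (Subtype.val : {i // i ≤ k} → Fin N) Subtype.val).det

/-- The function `∏ₖ Δₖ(X) ^ aₖ` of a matrix `X`, where `Δₖ` are the leading principal minors. It is
the matrix coefficient at a highest weight vector of weight `minorWeight a`. -/
def minorPower (a : Fin N → ℕ) (X : Matrix (Fin N) (Fin N) R) : R :=
  ∏ k, leadingMinor X k ^ a k

/-- The partition `i ↦ ∑_{k ≥ i} aₖ`, which has `aₖ` columns of length `k + 1`. -/
def minorWeight (a : Fin N → ℕ) (i : Fin N) : ℕ := ∑ k with i ≤ k, a k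

theorem leadingMinor_map {S : Type*} [CommRing S] (φ : R →+* S) (X : Matrix (Fin N) (Fin N) R)
    (k : Fin N) : leadingMinor (X.map φ) k = φ (leadingMinor X k) := by
  rw [leadingMinor, leadingMinor, RingHom.map_det]
  rfl

theorem minorPower_map {S : Type*} [CommRing S] (φ : R →+* S) (a : Fin N → ℕ)
    (X : Matrix (Fin N) (Fin N) R) : minorPower a (X.map φ) = φ (minorPower a X) := by
  simp only [minorPower, leadingMinor_map, map_prod, map_pow]

theorem leadingMinor_transpose (X : Matrix (Fin N) (Fin N) R) (k : Fin N) :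
    leadingMinor Xᵀ k = leadingMinor X k := by
  rw [leadingMinor, leadingMinor, ← Matrix.det_transpose]
  rfl

theorem leadingMinor_mul_left {L : Matrix (Fin N) (Fin N) R} (hL : ∀ i j, i < j → L i j = 0)
    (X : Matrix (Fin N) (Fin N) R) (k : Fin N) :
    leadingMinor (L * X) k = leadingMinor L k * leadingMinor X k := by
  rw [leadingMinor, leadingMinor, leadingMinor, ← Matrix.det_mul]
  congr 1
  ext i j
  simp only [Matrix.submatrix_apply, Matrix.mul_apply]
  rw [← Finset.sum_filter_add_sum_filter_not Finset.univ (· ≤ k),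
    Finset.sum_subtype (p := fun i => i ≤ k) _ (by simp),
    Finset.sum_eq_zero (s := Finset.univ.filter fun i => ¬ i ≤ k), add_zero]
  intro l hl
  rw [hL i l (i.2.trans_lt (by simpa using hl)), zero_mul]

theorem minorPower_transpose (a : Fin N → ℕ) (X : Matrix (Fin N) (Fin N) R) :
    minorPower a Xᵀ = minorPower a X := by
  simp only [minorPower, leadingMinor_transpose]

theorem minorPower_mul_left (a : Fin N → ℕ) {L : Matrix (Fin N) (Fin N) R}
    (hL : ∀ i j, i < j → L i j = 0) (X : Matrix (Fin N) (Fin N) R) :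
    minorPower a (L * X) = minorPower a L * minorPower a X := by
  simp only [minorPower, leadingMinor_mul_left hL, mul_pow, Finset.prod_mul_distrib]

theorem minorPower_mul_right (a : Fin N → ℕ) (X : Matrix (Fin N) (Fin N) R)
    {T : Matrix (Fin N) (Fin N) R} (hT : ∀ i j, j < i → T i j = 0) :
    minorPower a (X * T) = minorPower a X * minorPower a T := by
  rw [← minorPower_transpose, Matrix.transpose_mul,
    minorPower_mul_left a (L := Tᵀ) fun i j hij => hT j i hij, minorPower_transpose,
    minorPower_transpose, mul_comm]

theorem leadingMinor_of_upper {T : Matrix (Fin N) (Fin N) R} (hT : ∀ i j, j < i → T i j = 0)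
    (k : Fin N) : leadingMinor T k = ∏ i with i ≤ k, T i i := by
  rw [leadingMinor, Matrix.det_of_isUpperTriangular]
  · exact (Finset.prod_subtype (Finset.univ.filter (· ≤ k)) (by simp) fun i => T i i).symm
  · intro i j hij
    exact hT _ _ hij

theorem minorPower_of_upper (a : Fin N → ℕ) {T : Matrix (Fin N) (Fin N) R}
    (hT : ∀ i j, j < i → T i j = 0) : minorPower a T = ∏ i, T i i ^ minorWeight a i := by
  simp only [minorPower, leadingMinor_of_upper hT, ← Finset.prod_pow, minorWeight,
    ← Finset.prod_pow_eq_pow_sum]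
  exact Finset.prod_comm' (by simp)

theorem minorPower_diagonal (a : Fin N → ℕ) (s : Fin N → R) :
    minorPower a (Matrix.diagonal s) = ∏ i, s i ^ minorWeight a i := by
  rw [minorPower_of_upper a fun i j hij => Matrix.diagonal_apply_ne _ hij.ne']
  simp

theorem minorPower_one (a : Fin N → ℕ) : minorPower a (1 : Matrix (Fin N) (Fin N) R) = 1 := by
  rw [← Matrix.diagonal_one, minorPower_diagonal]
  simp

end Minors

section MinorsComplex

variable {N : ℕ}

/-- Triangular elimination: the rows of the lower triangular matrix `L` are the last rows of the
inverses of the leading principal blocks of `X`. -/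
theorem exists_lower_mul_eq_unitriangular {X : Matrix (Fin N) (Fin N) ℂ}
    (hX : ∀ k, leadingMinor X k ≠ 0) :
    ∃ L : Matrix (Fin N) (Fin N) ℂ, (∀ i j, i < j → L i j = 0) ∧
      (∀ i j, j < i → (L * X) i j = 0) ∧ ∀ i, (L * X) i i = 1 := by
  let S : ∀ k : Fin N, Matrix {i // i ≤ k} {i // i ≤ k} ℂ := fun k =>
    X.submatrix Subtype.val Subtype.val
  let L : Matrix (Fin N) (Fin N) ℂ := Matrix.of fun k i =>
    if h : i ≤ k then (S k)⁻¹ ⟨k, le_rfl⟩ ⟨i, h⟩ else 0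
  have key : ∀ k j (hj : j ≤ k),
      (L * X) k j = (1 : Matrix {i // i ≤ k} {i // i ≤ k} ℂ) ⟨k, le_rfl⟩ ⟨j, hj⟩ := by
    intro k j hj
    rw [← Matrix.nonsing_inv_mul (S k) (isUnit_iff_ne_zero.mpr (hX k)), Matrix.mul_apply,
      Matrix.mul_apply, ← Finset.sum_filter_add_sum_filter_not Finset.univ (· ≤ k)]
    rw [Finset.sum_subtype (p := fun i => i ≤ k) _ (by simp),
      Finset.sum_eq_zero (s := Finset.univ.filter fun i => ¬ i ≤ k), add_zero]
    · refine Finset.sum_congr rfl fun i _ => ?_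
      simp [L, S, i.2]
    · intro i hi
      simp only [Finset.mem_filter, Finset.mem_univ, true_and] at hi
      simp [L, hi]
  refine ⟨L, fun i j hij => ?_, fun i j hij => ?_, fun i => ?_⟩
  · simp [L, not_le.mpr hij]
  · rw [key i j hij.le, Matrix.one_apply_ne]
    simpa using hij.ne'
  · rw [key i i le_rfl, Matrix.one_apply_eq]

/-- Matrices with nonvanishing leading principal minors are dense: on the line `X + t` each minor
vanishes for finitely many `t` only. -/
theorem ext_of_leadingMinor_ne_zero {f g : Matrix (Fin N) (Fin N) ℂ → ℂ} (hf : Continuous f)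
    (hg : Continuous g) (h : ∀ X, (∀ k, leadingMinor X k ≠ 0) → f X = g X) : f = g := by
  funext X
  let Z : Set ℂ := ⋃ k : Fin N, {t | leadingMinor (X + Matrix.diagonal fun _ => t) k = 0}
  have hZ : Z.Finite := by
    refine Set.finite_iUnion fun k => ?_
    let S : Matrix {i // i ≤ k} {i // i ≤ k} ℂ := X.submatrix Subtype.val Subtype.val
    refine ((-S).charpoly.roots.toFinset.finite_toSet).subset fun t ht => ?_
    simp only [Finset.mem_coe, Multiset.mem_toFinset]
    rw [Polynomial.mem_roots (Matrix.charpoly_monic _).ne_zero, Polynomial.IsRoot,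
      Matrix.eval_charpoly, ← show leadingMinor (X + Matrix.diagonal fun _ => t) k = 0 from ht, leadingMinor]
    congr 1
    ext i j
    simp [S, Matrix.diagonal_apply, Matrix.scalar_apply, Subtype.ext_iff, add_comm]
  have hline : Continuous fun t : ℂ => X + Matrix.diagonal fun _ : Fin N => t := by fun_prop
  have := Continuous.ext_on (hZ.countable.dense_compl ℂ) (hf.comp hline) (hg.comp hline) fun t ht => by
    refine h _ fun k hk => ht ?_
    exact Set.mem_iUnion.mpr ⟨k, hk⟩
  simpa using congrFun this 0

theorem isPolyFunction_minorPower (a : Fin N → ℕ) :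
    IsPolyFunction (minorPower a : Matrix (Fin N) (Fin N) ℂ → ℂ) := by
  refine ⟨minorPower a (Matrix.of fun i j => MvPolynomial.X (i, j)), fun X => ?_⟩
  rw [← minorPower_map]
  congr 1
  ext i j
  simp

end MinorsComplex

/-! ### Spherical functions and their product formula -/

/-- The average of `minorPower a` over unitary conjugation: the spherical function of highest weight
`minorWeight a`, that is, the normalized character. -/
noncomputable def sphericalFunction {N : ℕ} [MeasurableSpace (Matrix.unitaryGroup (Fin N) ℂ)]
    (μ : Measure (Matrix.unitaryGroup (Fin N) ℂ)) (a : Fin N → ℕ) (X : Matrix (Fin N) (Fin N) ℂ) : ℂ :=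
  ∫ U : Matrix.unitaryGroup (Fin N) ℂ,
    minorPower a ((U : Matrix (Fin N) (Fin N) ℂ) * X * (U : Matrix (Fin N) (Fin N) ℂ)ᴴ) ∂μ

section Spherical

variable {N : ℕ}

theorem conjTranspose_mul_self_unitary (U : Matrix.unitaryGroup (Fin N) ℂ) :
    (U : Matrix (Fin N) (Fin N) ℂ)ᴴ * (U : Matrix (Fin N) (Fin N) ℂ) = 1 := by
  rw [← Matrix.star_eq_conjTranspose]
  exact Matrix.mem_unitaryGroup_iff'.mp U.2

theorem conjTranspose_mul_self_mul_unitary (U : Matrix.unitaryGroup (Fin N) ℂ)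
    (X : Matrix (Fin N) (Fin N) ℂ) :
    (U : Matrix (Fin N) (Fin N) ℂ)ᴴ * ((U : Matrix (Fin N) (Fin N) ℂ) * X) = X := by
  rw [← Matrix.mul_assoc, conjTranspose_mul_self_unitary, Matrix.one_mul]

theorem continuous_coe_unitary :
    Continuous fun U : Matrix.unitaryGroup (Fin N) ℂ => (U : Matrix (Fin N) (Fin N) ℂ) :=
  continuous_subtype_val

theorem continuous_conjTranspose_unitary :
    Continuous fun U : Matrix.unitaryGroup (Fin N) ℂ => (U : Matrix (Fin N) (Fin N) ℂ)ᴴ :=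
  continuous_subtype_val.matrix_conjTranspose

variable [MeasurableSpace (Matrix.unitaryGroup (Fin N) ℂ)]
  [BorelSpace (Matrix.unitaryGroup (Fin N) ℂ)]
  {μ : Measure (Matrix.unitaryGroup (Fin N) ℂ)} [μ.IsHaarMeasure]

/-- Invariance of the Haar measure under `U ↦ W * U`, in a form that is polynomial in `W` and
therefore holds for all matrices `W`. -/
theorem integral_translate_mul {p q : Matrix (Fin N) (Fin N) ℂ → ℂ} (hp : IsPolyFunction p)
    (hq : IsPolyFunction q) (W Y : Matrix (Fin N) (Fin N) ℂ) :
    ∫ U : Matrix.unitaryGroup (Fin N) ℂ, q ((U : Matrix (Fin N) (Fin N) ℂ)ᴴ * (W * Y)) *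
        p (U : Matrix (Fin N) (Fin N) ℂ) ∂μ =
      ∫ U : Matrix.unitaryGroup (Fin N) ℂ, q ((U : Matrix (Fin N) (Fin N) ℂ)ᴴ * Y) *
        p (W * (U : Matrix (Fin N) (Fin N) ℂ)) ∂μ := by
  refine congrFun (IsPolyFunction.ext_unitary
    (f := fun W => ∫ U : Matrix.unitaryGroup (Fin N) ℂ,
      q ((U : Matrix (Fin N) (Fin N) ℂ)ᴴ * (W * Y)) * p (U : Matrix (Fin N) (Fin N) ℂ) ∂μ)
    (g := fun W => ∫ U : Matrix.unitaryGroup (Fin N) ℂ,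
      q ((U : Matrix (Fin N) (Fin N) ℂ)ᴴ * Y) * p (W * (U : Matrix (Fin N) (Fin N) ℂ)) ∂μ)
    ?_ ?_ fun V => ?_) W
  · refine IsPolyFamily.integral μ (IsPolyFamily.mul (hq.comp (.mul (.const ?_) (.mul .id (.const
      continuous_const)))) (.const ?_))
    · exact continuous_conjTranspose_unitary
    · exact hp.continuous.comp continuous_coe_unitary
  · refine IsPolyFamily.integral μ (IsPolyFamily.mul (.const ?_) (hp.comp (.mul .id (.const ?_))))
    · exact hq.continuous.comp (continuous_conjTranspose_unitary.matrix_mul continuous_const)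
    · exact continuous_coe_unitary
  · rw [← integral_mul_left_eq_self _ V]
    simp only [Submonoid.coe_mul, Matrix.conjTranspose_mul, Matrix.mul_assoc,
      conjTranspose_mul_self_mul_unitary]

/-- The average of `U * A * U†` commutes with every matrix. -/
theorem integral_conj_mul_comm {f : Matrix (Fin N) (Fin N) ℂ → ℂ} (hf : IsPolyFunction f)
    (A W Y : Matrix (Fin N) (Fin N) ℂ) :
    ∫ U : Matrix.unitaryGroup (Fin N) ℂ, f ((U : Matrix (Fin N) (Fin N) ℂ) * A *
        (U : Matrix (Fin N) (Fin N) ℂ)ᴴ * (W * Y)) ∂μ =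
      ∫ U : Matrix.unitaryGroup (Fin N) ℂ, f (W * ((U : Matrix (Fin N) (Fin N) ℂ) * A *
        (U : Matrix (Fin N) (Fin N) ℂ)ᴴ * Y)) ∂μ := by
  have hc : Continuous fun U : Matrix.unitaryGroup (Fin N) ℂ =>
      (U : Matrix (Fin N) (Fin N) ℂ) * A * (U : Matrix (Fin N) (Fin N) ℂ)ᴴ :=
    (continuous_coe_unitary.matrix_mul continuous_const).matrix_mul
      continuous_conjTranspose_unitary
  refine congrFun (IsPolyFunction.ext_unitary
    (f := fun W => ∫ U : Matrix.unitaryGroup (Fin N) ℂ, f ((U : Matrix (Fin N) (Fin N) ℂ) * A *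
        (U : Matrix (Fin N) (Fin N) ℂ)ᴴ * (W * Y)) ∂μ)
    (g := fun W => ∫ U : Matrix.unitaryGroup (Fin N) ℂ, f (W *
      ((U : Matrix (Fin N) (Fin N) ℂ) * A * (U : Matrix (Fin N) (Fin N) ℂ)ᴴ * Y)) ∂μ)
    ?_ ?_ fun V => ?_) W
  · exact IsPolyFamily.integral μ (hf.comp (.mul (.const hc) (.mul .id (.const continuous_const))))
  · exact IsPolyFamily.integral μ (hf.comp (.mul .id
      (.const (hc.matrix_mul continuous_const))))
  · rw [← integral_mul_left_eq_self _ V]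
    simp only [Submonoid.coe_mul, Matrix.conjTranspose_mul, Matrix.mul_assoc,
      conjTranspose_mul_self_mul_unitary]

/-- The operator `f ↦ ∫ f (U A U† ·)` acts on `minorPower a` by a scalar: the result transforms
under triangular matrices on both sides as `minorPower a` does. -/
theorem integral_minorPower_conj_mul (a : Fin N → ℕ) (A Y : Matrix (Fin N) (Fin N) ℂ) :
    ∫ U : Matrix.unitaryGroup (Fin N) ℂ, minorPower a ((U : Matrix (Fin N) (Fin N) ℂ) * A *
        (U : Matrix (Fin N) (Fin N) ℂ)ᴴ * Y) ∂μ =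
      sphericalFunction μ a A * minorPower a Y := by
  have hf := isPolyFunction_minorPower a
  have hc : Continuous fun U : Matrix.unitaryGroup (Fin N) ℂ =>
      (U : Matrix (Fin N) (Fin N) ℂ) * A * (U : Matrix (Fin N) (Fin N) ℂ)ᴴ :=
    (continuous_coe_unitary.matrix_mul continuous_const).matrix_mul
      continuous_conjTranspose_unitary
  refine congrFun (ext_of_leadingMinor_ne_zero
    (f := fun Y => ∫ U : Matrix.unitaryGroup (Fin N) ℂ, minorPower a
      ((U : Matrix (Fin N) (Fin N) ℂ) * A * (U : Matrix (Fin N) (Fin N) ℂ)ᴴ * Y) ∂μ)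
    (g := fun Y => sphericalFunction μ a A * minorPower a Y) ?_ ?_ fun Y hY => ?_) Y
  · exact (IsPolyFamily.integral μ (hf.comp (.mul (.const hc) .id))).continuous
  · exact continuous_const.mul hf.continuous
  · obtain ⟨L, hL, hT, hT1⟩ := exists_lower_mul_eq_unitriangular hY
    have h1 : minorPower a L * minorPower a Y = 1 := by
      rw [← minorPower_mul_left a hL, minorPower_of_upper a hT]
      simp [hT1]
    have h2 := integral_conj_mul_comm (μ := μ) hf A L Y
    simp only [minorPower_mul_left a hL, minorPower_mul_right a _ hT] at h2
    rw [integral_mul_const, integral_const_mul, h1, mul_one] at h2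
    rw [sphericalFunction, h2, mul_right_comm, h1, one_mul]

theorem isPolyFunction_sphericalFunction (a : Fin N → ℕ) :
    IsPolyFunction (sphericalFunction μ a) :=
  IsPolyFamily.integral μ ((isPolyFunction_minorPower a).comp
    (.mul (.mul (.const continuous_coe_unitary) .id) (.const continuous_conjTranspose_unitary)))

omit [BorelSpace (Matrix.unitaryGroup (Fin N) ℂ)] [μ.IsHaarMeasure] in
theorem sphericalFunction_one [IsProbabilityMeasure μ] (a : Fin N → ℕ) : sphericalFunction μ a 1 = 1 := by
  have : ∀ U : Matrix.unitaryGroup (Fin N) ℂ, (U : Matrix (Fin N) (Fin N) ℂ) *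
      (U : Matrix (Fin N) (Fin N) ℂ)ᴴ = 1 := fun U => Matrix.mem_unitaryGroup_iff.mp U.2
  simp [sphericalFunction, this, minorPower_one]

theorem sphericalFunction_mul_comm [IsProbabilityMeasure μ] (a : Fin N → ℕ) (W X : Matrix (Fin N) (Fin N) ℂ) :
    sphericalFunction μ a (W * X) = sphericalFunction μ a (X * W) := by
  have hs := isPolyFunction_sphericalFunction (μ := μ) a
  refine congrFun (IsPolyFunction.ext_unitary
    (f := fun W => sphericalFunction μ a (W * X)) (g := fun W => sphericalFunction μ a (X * W))
    (hs.comp (Ω := Unit) (.mul .id (.const continuous_const))).isPolyFunction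
    (hs.comp (Ω := Unit) (.mul (.const continuous_const) .id)).isPolyFunction fun V => ?_) W
  have := integral_mul_right_eq_self (μ := μ) (fun U : Matrix.unitaryGroup (Fin N) ℂ =>
    minorPower a ((U : Matrix (Fin N) (Fin N) ℂ) * (X * (V : Matrix (Fin N) (Fin N) ℂ)) *
      (U : Matrix (Fin N) (Fin N) ℂ)ᴴ)) V
  rw [sphericalFunction, sphericalFunction, ← this]
  have hV : ∀ Z : Matrix (Fin N) (Fin N) ℂ, (V : Matrix (Fin N) (Fin N) ℂ) *
      ((V : Matrix (Fin N) (Fin N) ℂ)ᴴ * Z) = Z := fun Z => by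
    rw [← Matrix.mul_assoc, show (V : Matrix (Fin N) (Fin N) ℂ) *
      (V : Matrix (Fin N) (Fin N) ℂ)ᴴ = 1 from Matrix.mem_unitaryGroup_iff.mp V.2, Matrix.one_mul]
  simp only [Submonoid.coe_mul, Matrix.conjTranspose_mul, Matrix.mul_assoc, hV]

/-- The product formula for spherical functions. -/
theorem integral_sphericalFunction_conj_mul (a : Fin N → ℕ) (A B : Matrix (Fin N) (Fin N) ℂ) :
    ∫ U : Matrix.unitaryGroup (Fin N) ℂ, sphericalFunction μ a
      ((U : Matrix (Fin N) (Fin N) ℂ) * A * (U : Matrix (Fin N) (Fin N) ℂ)ᴴ * B) ∂μ =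
      sphericalFunction μ a A * sphericalFunction μ a B := by
  simp only [sphericalFunction]
  rw [integral_swap_of_continuous]
  · rw [← integral_const_mul]
    refine integral_congr_ae (.of_forall fun V => ?_)
    beta_reduce
    rw [← sphericalFunction, ← integral_minorPower_conj_mul, ← integral_mul_left_eq_self
      (fun U : Matrix.unitaryGroup (Fin N) ℂ => minorPower a ((U : Matrix (Fin N) (Fin N) ℂ) * A *
        (U : Matrix (Fin N) (Fin N) ℂ)ᴴ * _)) V]
    simp only [Submonoid.coe_mul, Matrix.conjTranspose_mul, Matrix.mul_assoc,
      conjTranspose_mul_self_mul_unitary]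
  · refine (isPolyFunction_minorPower a).continuous.comp ?_
    have h1 : Continuous fun p : Matrix.unitaryGroup (Fin N) ℂ × Matrix.unitaryGroup (Fin N) ℂ =>
        (p.1 : Matrix (Fin N) (Fin N) ℂ) := continuous_coe_unitary.comp continuous_fst
    have h2 : Continuous fun p : Matrix.unitaryGroup (Fin N) ℂ × Matrix.unitaryGroup (Fin N) ℂ =>
        (p.2 : Matrix (Fin N) (Fin N) ℂ) := continuous_coe_unitary.comp continuous_snd
    exact (h2.matrix_mul (((h1.matrix_mul continuous_const).matrix_mul
      h1.matrix_conjTranspose).matrix_mul continuous_const)).matrix_mul h2.matrix_conjTranspose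

end Spherical

/-! ### Orthogonality of the spherical functions -/

section Orthogonality

variable {N : ℕ}

theorem minorWeight_eq_add (a : Fin N → ℕ) (i : Fin N) :
    minorWeight a i = a i + if h : (i : ℕ) + 1 < N then minorWeight a ⟨i + 1, h⟩ else 0 := by
  have h1 : (Finset.univ.filter fun k => i ≤ k) = insert i (Finset.univ.filter fun k => i < k) := by
    ext k
    simp [le_iff_eq_or_lt, eq_comm]
  rw [minorWeight, h1, Finset.sum_insert (by simp)]
  congr 1
  split_ifs with h
  · rw [minorWeight]
    refine Finset.sum_congr (Finset.filter_congr fun k _ => ?_) fun _ _ => rfl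
    rw [Fin.lt_def, Fin.le_def, Nat.succ_le_iff]
  · refine Finset.sum_eq_zero fun k hk => ?_
    simp only [Finset.mem_filter, Finset.mem_univ, true_and, Fin.lt_def] at hk
    omega

theorem minorWeight_injective : Function.Injective (minorWeight : (Fin N → ℕ) → Fin N → ℕ) := by
  intro a c h
  funext i
  have h1 := minorWeight_eq_add a i
  rw [h, minorWeight_eq_add c i] at h1
  omega

theorem exists_minorWeight_eq {κ : Fin N → ℕ} (hκ : Antitone κ) : ∃ a, minorWeight a = κ := by
  let a : Fin N → ℕ := fun i => κ i - if h : (i : ℕ) + 1 < N then κ ⟨i + 1, h⟩ else 0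
  refine ⟨a, ?_⟩
  have key : ∀ m : ℕ, ∀ i : Fin N, N - i = m → minorWeight a i = κ i := by
    intro m
    induction m using Nat.strong_induction_on with
    | _ m ih =>
      intro i hi
      rw [minorWeight_eq_add]
      have hi' := i.2
      by_cases h : (i : ℕ) + 1 < N
      · have h1 := ih (N - (i + 1)) (by omega) ⟨i + 1, h⟩ rfl
        have h2 : κ ⟨i + 1, h⟩ ≤ κ i := hκ (by simp [Fin.le_def])
        simp only [a, h, dif_pos, h1]
        omega
      · simp [a, h]
  exact funext fun i => key _ i rfl

theorem minorPower_conjTranspose (a : Fin N → ℕ) (X : Matrix (Fin N) (Fin N) ℂ) :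
    minorPower a Xᴴ = star (minorPower a X) := by
  rw [Matrix.conjTranspose, show Xᵀ.map star = (X.map (starRingEnd ℂ))ᵀ from rfl,
    minorPower_transpose, minorPower_map]
  rfl

theorem IsPolyFunction.comp_mul_left {f : Matrix (Fin N) (Fin N) ℂ → ℂ} (hf : IsPolyFunction f)
    (X : Matrix (Fin N) (Fin N) ℂ) : IsPolyFunction fun Z => f (X * Z) :=
  (hf.comp (Ω := Unit) (.mul (.const continuous_const) .id)).isPolyFunction

variable [MeasurableSpace (Matrix.unitaryGroup (Fin N) ℂ)]
  [BorelSpace (Matrix.unitaryGroup (Fin N) ℂ)]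
  {μ : Measure (Matrix.unitaryGroup (Fin N) ℂ)} [μ.IsHaarMeasure]

theorem integral_minorPower_mul_lower (a c : Fin N → ℕ) (X Y : Matrix (Fin N) (Fin N) ℂ)
    {L : Matrix (Fin N) (Fin N) ℂ} (hL : ∀ i j, i < j → L i j = 0) :
    ∫ U : Matrix.unitaryGroup (Fin N) ℂ,
      minorPower a (X * ((U : Matrix (Fin N) (Fin N) ℂ)ᴴ * (L * Y))) *
        minorPower c (U : Matrix (Fin N) (Fin N) ℂ) ∂μ =
      minorPower c L * ∫ U : Matrix.unitaryGroup (Fin N) ℂ,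
        minorPower a (X * ((U : Matrix (Fin N) (Fin N) ℂ)ᴴ * Y)) *
          minorPower c (U : Matrix (Fin N) (Fin N) ℂ) ∂μ := by
  have := integral_translate_mul (μ := μ) (isPolyFunction_minorPower c)
    ((isPolyFunction_minorPower a).comp_mul_left X) L Y
  rw [this, ← integral_const_mul]
  refine integral_congr_ae (.of_forall fun U => ?_)
  simp only [minorPower_mul_left c hL]
  ring

omit [BorelSpace (Matrix.unitaryGroup (Fin N) ℂ)] [μ.IsHaarMeasure] in
theorem integral_minorPower_mul_upper (a c : Fin N → ℕ) (X : Matrix (Fin N) (Fin N) ℂ)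
    {T : Matrix (Fin N) (Fin N) ℂ} (hT : ∀ i j, j < i → T i j = 0) :
    ∫ U : Matrix.unitaryGroup (Fin N) ℂ,
      minorPower a (X * ((U : Matrix (Fin N) (Fin N) ℂ)ᴴ * T)) *
        minorPower c (U : Matrix (Fin N) (Fin N) ℂ) ∂μ =
      minorPower a T * ∫ U : Matrix.unitaryGroup (Fin N) ℂ,
        minorPower a (X * (U : Matrix (Fin N) (Fin N) ℂ)ᴴ) *
          minorPower c (U : Matrix (Fin N) (Fin N) ℂ) ∂μ := by
  rw [← integral_const_mul]
  refine integral_congr_ae (.of_forall fun U => ?_)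
  simp only [← Matrix.mul_assoc, minorPower_mul_right a _ hT]
  ring

/-- Under diagonal matrices the integral scales both by the weight of `a` and by that of `c`. -/
theorem integral_minorPower_mul_eq_zero {a c : Fin N → ℕ} (hac : a ≠ c)
    (X : Matrix (Fin N) (Fin N) ℂ) :
    ∫ U : Matrix.unitaryGroup (Fin N) ℂ,
        minorPower a (X * (U : Matrix (Fin N) (Fin N) ℂ)ᴴ) *
          minorPower c (U : Matrix (Fin N) (Fin N) ℂ) ∂μ = 0 := by
  obtain ⟨i, hi⟩ := Function.ne_iff.mp (minorWeight_injective.ne hac)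
  let s : Fin N → ℂ := Function.update 1 i 2
  have hs : ∀ w : Fin N → ℕ, ∏ j, s j ^ w j = 2 ^ w i := by
    intro w
    rw [Finset.prod_eq_single i]
    · simp [s]
    · intro j _ hj
      simp [s, hj]
    · simp
  have h1 := integral_minorPower_mul_lower (μ := μ) a c X 1 (L := Matrix.diagonal s)
    fun i j hij => Matrix.diagonal_apply_ne _ hij.ne
  rw [Matrix.mul_one, integral_minorPower_mul_upper a c X (T := Matrix.diagonal s)
    fun i j hij => Matrix.diagonal_apply_ne _ hij.ne', minorPower_diagonal, minorPower_diagonal,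
    hs, hs] at h1
  simp only [Matrix.mul_one] at h1
  have h2 : (2 : ℂ) ^ minorWeight a i ≠ 2 ^ minorWeight c i := by
    intro h
    have : (2 : ℕ) ^ minorWeight a i = 2 ^ minorWeight c i := by exact_mod_cast h
    exact hi (Nat.pow_right_injective le_rfl this)
  by_contra h
  exact h2 (mul_right_cancel₀ h h1)

theorem isPolyFunction_integral_minorPower_mul (a c : Fin N → ℕ) (X : Matrix (Fin N) (Fin N) ℂ) :
    IsPolyFunction fun Y => ∫ U : Matrix.unitaryGroup (Fin N) ℂ,
      minorPower a (X * ((U : Matrix (Fin N) (Fin N) ℂ)ᴴ * Y)) *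
        minorPower c (U : Matrix (Fin N) (Fin N) ℂ) ∂μ :=
  IsPolyFamily.integral μ (IsPolyFamily.mul ((isPolyFunction_minorPower a).comp
    (.mul (.const continuous_const) (.mul (.const continuous_conjTranspose_unitary) .id)))
    (.const ((isPolyFunction_minorPower c).continuous.comp continuous_coe_unitary)))

theorem integral_minorPower_mul_mul_eq_zero {a c : Fin N → ℕ} (hac : a ≠ c)
    (X Y : Matrix (Fin N) (Fin N) ℂ) :
    ∫ U : Matrix.unitaryGroup (Fin N) ℂ,
      minorPower a (X * ((U : Matrix (Fin N) (Fin N) ℂ)ᴴ * Y)) *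
        minorPower c (U : Matrix (Fin N) (Fin N) ℂ) ∂μ = 0 := by
  refine congrFun (ext_of_leadingMinor_ne_zero
    (isPolyFunction_integral_minorPower_mul (μ := μ) a c X).continuous
    (g := fun _ => 0) continuous_const fun Y hY => ?_) Y
  obtain ⟨L, hL, hT, hT1⟩ := exists_lower_mul_eq_unitriangular hY
  have h1 : minorPower c L * minorPower c Y = 1 := by
    rw [← minorPower_mul_left c hL, minorPower_of_upper c hT]
    simp [hT1]
  have h2 := integral_minorPower_mul_lower (μ := μ) a c X Y hL
  rw [integral_minorPower_mul_upper a c X hT, integral_minorPower_mul_eq_zero hac, mul_zero] at h2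
  exact (mul_eq_zero.mp h2.symm).resolve_left (left_ne_zero_of_mul_eq_one h1)

theorem integral_minorPower_mul_self (a : Fin N → ℕ) (X Y : Matrix (Fin N) (Fin N) ℂ) :
    ∫ U : Matrix.unitaryGroup (Fin N) ℂ,
      minorPower a (X * ((U : Matrix (Fin N) (Fin N) ℂ)ᴴ * Y)) *
        minorPower a (U : Matrix (Fin N) (Fin N) ℂ) ∂μ =
      minorPower a Y * ∫ U : Matrix.unitaryGroup (Fin N) ℂ,
        minorPower a (X * (U : Matrix (Fin N) (Fin N) ℂ)ᴴ) *
          minorPower a (U : Matrix (Fin N) (Fin N) ℂ) ∂μ := by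
  refine congrFun (ext_of_leadingMinor_ne_zero
    (isPolyFunction_integral_minorPower_mul (μ := μ) a a X).continuous
    (g := fun Y => minorPower a Y * ∫ U : Matrix.unitaryGroup (Fin N) ℂ,
        minorPower a (X * (U : Matrix (Fin N) (Fin N) ℂ)ᴴ) *
          minorPower a (U : Matrix (Fin N) (Fin N) ℂ) ∂μ)
    ((isPolyFunction_minorPower a).continuous.mul continuous_const) fun Y hY => ?_) Y
  obtain ⟨L, hL, hT, hT1⟩ := exists_lower_mul_eq_unitriangular hY
  have h0 : minorPower a (L * Y) = 1 := by
    rw [minorPower_of_upper a hT]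
    simp [hT1]
  have h1 : minorPower a Y * minorPower a L = 1 := by
    rw [mul_comm, ← minorPower_mul_left a hL, h0]
  have h2 := integral_minorPower_mul_lower (μ := μ) a a X Y hL
  rw [integral_minorPower_mul_upper a a X hT, h0, one_mul] at h2
  rw [h2, ← mul_assoc, h1, one_mul]

theorem integral_minorPower_mul_conjTranspose [IsProbabilityMeasure μ]
    (a : Fin N → ℕ) (X : Matrix (Fin N) (Fin N) ℂ) :
    ∫ U : Matrix.unitaryGroup (Fin N) ℂ,
        minorPower a (X * (U : Matrix (Fin N) (Fin N) ℂ)ᴴ) *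
          minorPower a (U : Matrix (Fin N) (Fin N) ℂ) ∂μ =
      minorPower a X * ∫ U : Matrix.unitaryGroup (Fin N) ℂ,
        minorPower a (U : Matrix (Fin N) (Fin N) ℂ)ᴴ *
          minorPower a (U : Matrix (Fin N) (Fin N) ℂ) ∂μ := by
  have hp := isPolyFunction_minorPower (N := N) a
  have hpoly : IsPolyFunction fun X => ∫ U : Matrix.unitaryGroup (Fin N) ℂ,
        minorPower a (X * (U : Matrix (Fin N) (Fin N) ℂ)ᴴ) *
          minorPower a (U : Matrix (Fin N) (Fin N) ℂ) ∂μ :=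
    IsPolyFamily.integral μ (IsPolyFamily.mul (hp.comp
      (.mul .id (.const continuous_conjTranspose_unitary)))
      (.const (hp.continuous.comp continuous_coe_unitary)))
  have hpoly' : IsPolyFunction fun X => ∫ U : Matrix.unitaryGroup (Fin N) ℂ,
        minorPower a (U : Matrix (Fin N) (Fin N) ℂ)ᴴ *
          minorPower a ((U : Matrix (Fin N) (Fin N) ℂ) * X) ∂μ :=
    IsPolyFamily.integral μ (IsPolyFamily.mul
      (.const (hp.continuous.comp continuous_conjTranspose_unitary))
      (hp.comp (.mul (.const continuous_coe_unitary) .id)))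
  -- By right invariance `X` may be moved to the second factor.
  have hmove := IsPolyFunction.ext_unitary hpoly hpoly' fun V => by
    rw [← integral_mul_right_eq_self _ V]
    have hV : ∀ Z : Matrix (Fin N) (Fin N) ℂ, (V : Matrix (Fin N) (Fin N) ℂ) *
        ((V : Matrix (Fin N) (Fin N) ℂ)ᴴ * Z) = Z := fun Z => by
      rw [← Matrix.mul_assoc, show (V : Matrix (Fin N) (Fin N) ℂ) *
        (V : Matrix (Fin N) (Fin N) ℂ)ᴴ = 1 from Matrix.mem_unitaryGroup_iff.mp V.2,
        Matrix.one_mul]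
    simp only [Submonoid.coe_mul, Matrix.conjTranspose_mul, hV]
  refine congrFun (ext_of_leadingMinor_ne_zero hpoly.continuous
    (g := fun X => minorPower a X * ∫ U : Matrix.unitaryGroup (Fin N) ℂ,
        minorPower a (U : Matrix (Fin N) (Fin N) ℂ)ᴴ *
          minorPower a (U : Matrix (Fin N) (Fin N) ℂ) ∂μ)
    (hp.continuous.mul continuous_const) fun Y hY => ?_) X
  obtain ⟨L, hL, hT, hT1⟩ := exists_lower_mul_eq_unitriangular hY
  have h0 : minorPower a (L * Y) = 1 := by
    rw [minorPower_of_upper a hT]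
    simp [hT1]
  have h1 : minorPower a Y * minorPower a L = 1 := by
    rw [mul_comm, ← minorPower_mul_left a hL, h0]
  have h2 := congrFun hmove (L * Y)
  simp only [minorPower_mul_right a _ hT, h0, mul_one] at h2
  rw [← h2]
  simp only [Matrix.mul_assoc, minorPower_mul_left a hL]
  simp only [mul_assoc, integral_const_mul]
  rw [← mul_assoc, h1, one_mul]

theorem integral_minorPower_conjTranspose_mul_self_ne_zero (a : Fin N → ℕ) :
    ∫ U : Matrix.unitaryGroup (Fin N) ℂ, minorPower a (U : Matrix (Fin N) (Fin N) ℂ)ᴴ *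
      minorPower a (U : Matrix (Fin N) (Fin N) ℂ) ∂μ ≠ 0 := by
  have hc : Continuous fun U : Matrix.unitaryGroup (Fin N) ℂ =>
      ‖minorPower a (U : Matrix (Fin N) (Fin N) ℂ)‖ ^ 2 :=
    ((isPolyFunction_minorPower a).continuous.comp continuous_coe_unitary).norm.pow 2
  have h : ∀ U : Matrix.unitaryGroup (Fin N) ℂ, minorPower a (U : Matrix (Fin N) (Fin N) ℂ)ᴴ *
      minorPower a (U : Matrix (Fin N) (Fin N) ℂ) =
      ((‖minorPower a (U : Matrix (Fin N) (Fin N) ℂ)‖ ^ 2 : ℝ) : ℂ) := by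
    intro U
    rw [minorPower_conjTranspose]
    push_cast
    exact Complex.conj_mul' _
  simp only [h]
  rw [integral_complex_ofReal, Complex.ofReal_ne_zero]
  refine (hc.integral_pos_of_hasCompactSupport_nonneg_nonzero
    (HasCompactSupport.of_compactSpace _) (fun U => by positivity) (x := 1) ?_).ne'
  simp [minorPower_one]

theorem integral_sphericalFunction_mul_minorPower (a c : Fin N → ℕ) :
    ∫ U : Matrix.unitaryGroup (Fin N) ℂ,
      sphericalFunction μ a (U : Matrix (Fin N) (Fin N) ℂ)ᴴ *
        minorPower c (U : Matrix (Fin N) (Fin N) ℂ) ∂μ =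
      ∫ V : Matrix.unitaryGroup (Fin N) ℂ, ∫ U : Matrix.unitaryGroup (Fin N) ℂ,
        minorPower a ((V : Matrix (Fin N) (Fin N) ℂ) * ((U : Matrix (Fin N) (Fin N) ℂ)ᴴ *
          (V : Matrix (Fin N) (Fin N) ℂ)ᴴ)) *
          minorPower c (U : Matrix (Fin N) (Fin N) ℂ) ∂μ ∂μ := by
  rw [← integral_swap_of_continuous]
  · refine integral_congr_ae (.of_forall fun U => ?_)
    simp only [sphericalFunction, integral_mul_const, Matrix.mul_assoc]
  · have h1 : Continuous fun p : Matrix.unitaryGroup (Fin N) ℂ × Matrix.unitaryGroup (Fin N) ℂ =>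
        (p.1 : Matrix (Fin N) (Fin N) ℂ) := continuous_coe_unitary.comp continuous_fst
    have h2 : Continuous fun p : Matrix.unitaryGroup (Fin N) ℂ × Matrix.unitaryGroup (Fin N) ℂ =>
        (p.2 : Matrix (Fin N) (Fin N) ℂ) := continuous_coe_unitary.comp continuous_snd
    exact ((isPolyFunction_minorPower a).continuous.comp (h2.matrix_mul
      (h1.matrix_conjTranspose.matrix_mul h2.matrix_conjTranspose))).mul
      ((isPolyFunction_minorPower c).continuous.comp h1)

theorem integral_sphericalFunction_mul_minorPower_of_ne {a c : Fin N → ℕ} (hac : a ≠ c) :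
    ∫ U : Matrix.unitaryGroup (Fin N) ℂ,
      sphericalFunction μ a (U : Matrix (Fin N) (Fin N) ℂ)ᴴ *
        minorPower c (U : Matrix (Fin N) (Fin N) ℂ) ∂μ = 0 := by
  simp [integral_sphericalFunction_mul_minorPower, integral_minorPower_mul_mul_eq_zero hac]

theorem integral_sphericalFunction_mul_minorPower_self_ne_zero [IsProbabilityMeasure μ]
    (a : Fin N → ℕ) :
    ∫ U : Matrix.unitaryGroup (Fin N) ℂ,
      sphericalFunction μ a (U : Matrix (Fin N) (Fin N) ℂ)ᴴ *
        minorPower a (U : Matrix (Fin N) (Fin N) ℂ) ∂μ ≠ 0 := by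
  simp only [integral_sphericalFunction_mul_minorPower, integral_minorPower_mul_self,
    integral_minorPower_mul_conjTranspose]
  simp only [← mul_assoc, integral_mul_const]
  exact mul_ne_zero (integral_minorPower_conjTranspose_mul_self_ne_zero a)
    (integral_minorPower_conjTranspose_mul_self_ne_zero a)

end Orthogonality

/-! ### Leading monomials of the spherical functions -/

section LeadingMonomials

open scoped MonomialOrder

theorem lex_lt_iff_exists {N : ℕ} {c d : Fin N →₀ ℕ} :
    c ≺[MonomialOrder.lex] d ↔ ∃ j, (∀ i < j, c i = d i) ∧ c j < d j :=
  Iff.rfl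

/-- If `d` dominates `c`, then `c` is lexicographically at most `d`. -/
theorem lex_le_of_sum_le {N : ℕ} {c d : Fin N →₀ ℕ}
    (h : ∀ k, ∑ i with i ≤ k, c i ≤ ∑ i with i ≤ k, d i) : c ≼[MonomialOrder.lex] d := by
  by_contra! hlt
  obtain ⟨j, hj, hlt⟩ := lex_lt_iff_exists.mp hlt
  refine (h j).not_gt (Finset.sum_lt_sum (fun i hi => ?_) ⟨j, by simp, hlt⟩)
  rcases (Finset.mem_filter.mp hi).2.lt_or_eq with hij | rfl
  · exact (hj i hij).le
  · exact hlt.le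

/-- The polynomial `f` has no monomial above `d`, and its coefficient at `d` is `c` (possibly
zero). -/
def HasTopCoeff {N : ℕ} {R : Type*} [CommRing R] (f : MvPolynomial (Fin N) R) (d : Fin N →₀ ℕ)
    (c : R) : Prop :=
  MonomialOrder.lex.degree f ≼[MonomialOrder.lex] d ∧ f.coeff d = c

variable {N : ℕ} {R : Type*} [CommRing R]

theorem HasTopCoeff.mul {f g : MvPolynomial (Fin N) R} {d e : Fin N →₀ ℕ} {b c : R}
    (hf : HasTopCoeff f d b) (hg : HasTopCoeff g e c) : HasTopCoeff (f * g) (d + e) (b * c) := by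
  refine ⟨MonomialOrder.degree_mul_le.trans ?_, ?_⟩
  · rw [map_add, map_add]
    exact add_le_add hf.1 hg.1
  · rw [MonomialOrder.coeff_mul_of_add_of_degree_le hf.1 hg.1, hf.2, hg.2]

theorem HasTopCoeff.one : HasTopCoeff (1 : MvPolynomial (Fin N) R) 0 1 := by
  refine ⟨?_, by simp⟩
  simp

theorem HasTopCoeff.pow {f : MvPolynomial (Fin N) R} {d : Fin N →₀ ℕ} {c : R}
    (hf : HasTopCoeff f d c) (n : ℕ) : HasTopCoeff (f ^ n) (n • d) (c ^ n) := by
  induction n with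
  | zero => simpa using HasTopCoeff.one
  | succ n ih => simpa [pow_succ, succ_nsmul] using ih.mul hf

theorem HasTopCoeff.prod {ι : Type*} (s : Finset ι) {f : ι → MvPolynomial (Fin N) R}
    {d : ι → Fin N →₀ ℕ} {c : ι → R} (hf : ∀ i, HasTopCoeff (f i) (d i) (c i)) :
    HasTopCoeff (∏ i ∈ s, f i) (∑ i ∈ s, d i) (∏ i ∈ s, c i) := by
  classical
  induction s using Finset.induction_on with
  | empty => simpa using HasTopCoeff.one
  | insert i s hi ih =>
    rw [Finset.prod_insert hi, Finset.sum_insert hi, Finset.prod_insert hi]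
    exact (hf i).mul ih

/-- The expansion of a leading minor of `U * diagonal x * V` (the Cauchy–Binet formula before
the terms are collected into minors of `U`). -/
theorem leadingMinor_mul_diagonal_mul (U V : Matrix (Fin N) (Fin N) R) (x : Fin N → R)
    (k : Fin N) :
    leadingMinor (U * Matrix.diagonal x * V) k =
      ∑ p : {i // i ≤ k} → Fin N, (∏ i : {i // i ≤ k}, U i.1 (p i) * x (p i)) *
        (V.submatrix p (Subtype.val : {i // i ≤ k} → Fin N)).det := by
  have h : (U * Matrix.diagonal x * V).submatrix (Subtype.val : {i // i ≤ k} → Fin N) Subtype.val =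
      Matrix.of fun i : {i // i ≤ k} => ∑ j, (U i.1 j * x j) • fun i' : {i // i ≤ k} => V j i' := by
    ext i i'
    simp [Matrix.mul_apply, Matrix.diagonal_apply, Finset.sum_apply]
  rw [leadingMinor, h]
  change Matrix.detRowAlternating.toMultilinearMap
    (fun i : {i // i ≤ k} => ∑ j, (U i.1 j * x j) • fun i' : {i // i ≤ k} => V j i') = _
  rw [MultilinearMap.map_sum]
  refine Finset.sum_congr rfl fun p _ => ?_
  rw [MultilinearMap.map_smul_univ]
  rfl

theorem det_submatrix_eq_zero_of_not_injective (V : Matrix (Fin N) (Fin N) R) {k : Fin N}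
    {p : {i // i ≤ k} → Fin N} (hp : ¬ Function.Injective p) :
    (V.submatrix p (Subtype.val : {i // i ≤ k} → Fin N)).det = 0 := by
  simp only [Function.Injective, not_forall] at hp
  obtain ⟨i, j, hij, hne⟩ := hp
  exact Matrix.det_zero_of_row_eq hne (by funext l; simp [hij])

/-- The exponent of `∏_{i ≤ k} x_i`. -/
noncomputable def initialExponent (k : Fin N) : Fin N →₀ ℕ :=
  Finsupp.equivFunOnFinite.symm fun i => if i ≤ k then 1 else 0

theorem sum_single_apply {k : Fin N} (p : {i // i ≤ k} → Fin N) (j : Fin N) :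
    (∑ i, Finsupp.single (p i) 1) j = (Finset.univ.filter fun i => p i = j).card := by
  rw [Finsupp.finsetSum_apply, Finset.card_filter]
  exact Finset.sum_congr rfl fun i _ => Finsupp.single_apply

theorem sum_single_lex_le {k : Fin N} {p : {i // i ≤ k} → Fin N} (hp : Function.Injective p) :
    (∑ i, Finsupp.single (p i) 1) ≼[MonomialOrder.lex] initialExponent k := by
  refine lex_le_of_sum_le fun j => ?_
  simp only [sum_single_apply, initialExponent, Finsupp.equivFunOnFinite_symm_apply_apply]
  have h1 : ∑ x with x ≤ j, (Finset.univ.filter fun i => p i = x).card =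
      (Finset.univ.filter fun i => p i ≤ j).card := by
    rw [Finset.card_eq_sum_card_fiberwise (f := p) (t := Finset.univ.filter (· ≤ j))
      (fun i hi => by simpa using hi)]
    refine Finset.sum_congr rfl fun x hx => ?_
    rw [Finset.filter_filter]
    refine congrArg _ (Finset.filter_congr fun i _ => ⟨fun h => ⟨?_, h⟩, fun h => h.2⟩)
    simpa [h] using hx
  rw [h1, ← Finset.card_filter, Finset.filter_filter]
  rcases le_total j k with hjk | hjk
  · rw [← Finset.card_image_of_injective _ hp]
    refine Finset.card_le_card fun x hx => ?_
    obtain ⟨i, hi, rfl⟩ := Finset.mem_image.mp hx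
    have hi' : p i ≤ j := by simpa using hi
    simp [hi', hi'.trans hjk]
  · refine (Finset.card_le_univ _).trans ?_
    rw [Fintype.card_subtype]
    refine Finset.card_le_card fun x hx => ?_
    have hx' : x ≤ k := by simpa using hx
    simp [hx', hx'.trans hjk]

theorem sum_single_eq_initialExponent_iff {k : Fin N} {p : {i // i ≤ k} → Fin N}
    (hp : Function.Injective p) :
    ∑ i, Finsupp.single (p i) 1 = initialExponent k ↔ ∀ i, p i ≤ k := by
  constructor
  · intro h i
    by_contra hi
    have := DFunLike.congr_fun h (p i)
    rw [sum_single_apply, initialExponent, Finsupp.equivFunOnFinite_symm_apply_apply, if_neg hi,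
      Finset.card_eq_zero] at this
    exact Finset.notMem_empty i (this ▸ by simp)
  · intro h
    have hb : Function.Bijective fun i => (⟨p i, h i⟩ : {i // i ≤ k}) :=
      Finite.injective_iff_bijective.mp fun i j hij => hp (congrArg Subtype.val hij)
    have : ∑ i, Finsupp.single (p i) 1 = ∑ i : {i // i ≤ k}, Finsupp.single (i : Fin N) 1 :=
      hb.sum_comp fun i : {i // i ≤ k} => Finsupp.single (i : Fin N) 1
    rw [this]
    ext j
    rw [sum_single_apply, initialExponent, Finsupp.equivFunOnFinite_symm_apply_apply]
    split_ifs with hj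
    · rw [Finset.card_eq_one]
      exact ⟨⟨j, hj⟩, by ext i; simp [Subtype.ext_iff]⟩
    · rw [Finset.card_eq_zero]
      ext i
      simpa using fun h : (i : Fin N) = j => hj (h ▸ i.2)

/-- The top coefficient of a leading minor of `U * diagonal x * V` is found by setting `x_i = 1`
for `i ≤ k` and `x_i = 0` otherwise. -/
theorem hasTopCoeff_leadingMinor (U V : Matrix (Fin N) (Fin N) R) (k : Fin N) :
    HasTopCoeff (leadingMinor (U.map MvPolynomial.C * Matrix.diagonal MvPolynomial.X *
      V.map MvPolynomial.C) k) (initialExponent k) (leadingMinor U k * leadingMinor V k) := by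
  classical
  let c : ({i // i ≤ k} → Fin N) → R := fun p =>
    (∏ i : {i // i ≤ k}, U i.1 (p i)) * (V.submatrix p (Subtype.val : {i // i ≤ k} → Fin N)).det
  have hexp : leadingMinor (U.map MvPolynomial.C * Matrix.diagonal MvPolynomial.X *
      V.map MvPolynomial.C) k =
      ∑ p : {i // i ≤ k} → Fin N with Function.Injective p,
        MvPolynomial.monomial (∑ i, Finsupp.single (p i) 1) (c p) := by
    rw [leadingMinor_mul_diagonal_mul, Finset.sum_filter]
    refine Finset.sum_congr rfl fun p _ => ?_
    split_ifs with hp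
    · rw [Finset.prod_mul_distrib, Matrix.submatrix_map,
        show ((V.submatrix p Subtype.val).map MvPolynomial.C).det =
          MvPolynomial.C (σ := Fin N) (V.submatrix p Subtype.val).det from
          (RingHom.map_det _ _).symm]
      simp only [Matrix.map_apply, c]
      rw [← map_prod, mul_right_comm, ← map_mul, MvPolynomial.monomial_sum_index]
      rfl
    · rw [det_submatrix_eq_zero_of_not_injective _ hp, mul_zero]
  constructor
  · rw [hexp]
    refine MonomialOrder.degree_sum_le.trans (Finset.sup_le fun p hp => ?_)
    exact (MonomialOrder.degree_monomial_le _).trans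
      (sum_single_lex_le (Finset.mem_filter.mp hp).2)
  · let x : Fin N → R := fun i => if i ≤ k then 1 else 0
    have h1 : leadingMinor (U * Matrix.diagonal x * V) k = leadingMinor U k * leadingMinor V k := by
      rw [leadingMinor, leadingMinor, leadingMinor, ← Matrix.det_mul]
      congr 1
      ext i j
      rw [Matrix.submatrix_apply, Matrix.mul_apply, Matrix.mul_apply]
      simp only [Matrix.submatrix_apply, Matrix.mul_diagonal]
      rw [← Finset.sum_filter_add_sum_filter_not Finset.univ (· ≤ k),
        Finset.sum_subtype (p := fun i => i ≤ k) _ (by simp),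
        Finset.sum_eq_zero (s := Finset.univ.filter fun i => ¬ i ≤ k), add_zero]
      · exact Finset.sum_congr rfl fun l _ => by simp [x, l.2]
      · intro l hl
        simp [x, (Finset.mem_filter.mp hl).2]
    rw [hexp, ← h1, leadingMinor_mul_diagonal_mul, MvPolynomial.coeff_sum, Finset.sum_filter]
    refine Finset.sum_congr rfl fun p _ => ?_
    split_ifs with hp
    · rw [MvPolynomial.coeff_monomial, Finset.prod_mul_distrib]
      by_cases h : ∀ i, p i ≤ k
      · rw [if_pos ((sum_single_eq_initialExponent_iff hp).mpr h)]
        simp [c, x, h]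
      · rw [if_neg (mt (sum_single_eq_initialExponent_iff hp).mp h)]
        push Not at h
        obtain ⟨i, hi⟩ := h
        rw [Finset.prod_eq_zero (f := fun i => x (p i)) (Finset.mem_univ i)]
        · simp
        · simp [x, hi]
    · rw [det_submatrix_eq_zero_of_not_injective _ hp, mul_zero]

theorem sum_smul_initialExponent (a : Fin N → ℕ) :
    ∑ k, a k • initialExponent k = Finsupp.equivFunOnFinite.symm (minorWeight a) := by
  ext i
  simp [initialExponent, minorWeight, Finset.sum_filter]

theorem hasTopCoeff_minorPower (a : Fin N → ℕ) (U V : Matrix (Fin N) (Fin N) R) :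
    HasTopCoeff (minorPower a (U.map MvPolynomial.C * Matrix.diagonal MvPolynomial.X *
      V.map MvPolynomial.C)) (Finsupp.equivFunOnFinite.symm (minorWeight a))
      (minorPower a U * minorPower a V) := by
  rw [← sum_smul_initialExponent, minorPower, minorPower, minorPower, ← Finset.prod_mul_distrib]
  simp only [← mul_pow]
  exact HasTopCoeff.prod _ fun k => (hasTopCoeff_leadingMinor U V k).pow (a k)

/-- The leading exponent of a symmetric polynomial is a partition. -/
theorem antitone_degree_of_isSymmetric {g : MvPolynomial (Fin N) ℂ} (hg : g.IsSymmetric)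
    (hg0 : g ≠ 0) : Antitone (MonomialOrder.lex.degree g) := by
  intro i j hij
  by_contra! hlt
  have hne : i ≠ j := fun h => by simp [h] at hlt
  set κ := MonomialOrder.lex.degree g
  let m : Fin N →₀ ℕ := κ.mapDomain (Equiv.swap i j)
  have hm : m ∈ g.support := by
    rw [MvPolynomial.mem_support_iff, ← hg (Equiv.swap i j),
      MvPolynomial.coeff_rename_mapDomain _ (Equiv.injective _)]
    exact MonomialOrder.coeff_degree_ne_zero_iff.mpr hg0
  refine (MonomialOrder.lex.le_degree hm).not_gt ?_
  have hmv : ∀ l, m l = κ (Equiv.swap i j l) := fun l => by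
    conv_lhs => rw [← Equiv.swap_apply_self i j l]
    exact Finsupp.mapDomain_apply (Equiv.injective _) _ _
  refine lex_lt_iff_exists.mpr ⟨i, fun l hl => ?_, ?_⟩
  · change κ l = m l
    rw [hmv, Equiv.swap_apply_of_ne_of_ne hl.ne (hl.trans_le hij).ne]
  · change κ i < m i
    rw [hmv, Equiv.swap_apply_left]
    exact hlt

end LeadingMonomials

section SphericalPolynomial

open scoped MonomialOrder

variable {N : ℕ} [MeasurableSpace (Matrix.unitaryGroup (Fin N) ℂ)]

/-- The unitary matrix `U` as a matrix of continuous functions of `U`. -/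
noncomputable def tautologicalUnitary (N : ℕ) :
    Matrix (Fin N) (Fin N) C(Matrix.unitaryGroup (Fin N) ℂ, ℂ) :=
  Matrix.of fun i j => ⟨fun U => (U : Matrix (Fin N) (Fin N) ℂ) i j,
    continuous_coe_unitary.matrix_elem i j⟩

/-- The conjugate transpose `U†` as a matrix of continuous functions of `U`. -/
noncomputable def tautologicalUnitaryStar (N : ℕ) :
    Matrix (Fin N) (Fin N) C(Matrix.unitaryGroup (Fin N) ℂ, ℂ) :=
  Matrix.of fun i j => ⟨fun U => (U : Matrix (Fin N) (Fin N) ℂ)ᴴ i j,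
    continuous_conjTranspose_unitary.matrix_elem i j⟩

/-- The spherical function as a polynomial in the eigenvalues. -/
noncomputable def sphericalPolynomial (μ : Measure (Matrix.unitaryGroup (Fin N) ℂ))
    (a : Fin N → ℕ) : MvPolynomial (Fin N) ℂ :=
  integralCoeff μ (minorPower a ((tautologicalUnitary N).map MvPolynomial.C *
    Matrix.diagonal MvPolynomial.X * (tautologicalUnitaryStar N).map MvPolynomial.C))

variable [BorelSpace (Matrix.unitaryGroup (Fin N) ℂ)]
  {μ : Measure (Matrix.unitaryGroup (Fin N) ℂ)} [μ.IsHaarMeasure]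

theorem eval_sphericalPolynomial (a : Fin N → ℕ) (x : Fin N → ℂ) :
    MvPolynomial.eval x (sphericalPolynomial μ a) =
      sphericalFunction μ a (Matrix.diagonal x) := by
  rw [sphericalPolynomial, eval_integralCoeff, sphericalFunction]
  refine integral_congr_ae (.of_forall fun U => ?_)
  beta_reduce
  rw [← MvPolynomial.coe_eval₂Hom, ← minorPower_map, Matrix.map_mul, Matrix.map_mul]
  have h1 : ((tautologicalUnitary N).map MvPolynomial.C).map
      (MvPolynomial.eval₂Hom ((Pi.evalRingHom (fun _ => ℂ) U).comp
        ContinuousMap.coeFnRingHom) x) = (U : Matrix (Fin N) (Fin N) ℂ) := by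
    ext i j
    simp only [Matrix.map_apply, MvPolynomial.eval₂Hom_C]
    rfl
  have h2 : ((tautologicalUnitaryStar N).map MvPolynomial.C).map
      (MvPolynomial.eval₂Hom ((Pi.evalRingHom (fun _ => ℂ) U).comp
        ContinuousMap.coeFnRingHom) x) = (U : Matrix (Fin N) (Fin N) ℂ)ᴴ := by
    ext i j
    simp only [Matrix.map_apply, MvPolynomial.eval₂Hom_C]
    rfl
  have h3 : (Matrix.diagonal MvPolynomial.X :
      Matrix (Fin N) (Fin N) (MvPolynomial (Fin N) C(Matrix.unitaryGroup (Fin N) ℂ, ℂ))).map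
      (MvPolynomial.eval₂Hom ((Pi.evalRingHom (fun _ => ℂ) U).comp
        ContinuousMap.coeFnRingHom) x) = Matrix.diagonal x := by
    rw [Matrix.diagonal_map (map_zero _)]
    congr 1
    funext i
    exact MvPolynomial.eval₂Hom_X' _ _ _
  rw [h1, h2, h3]

theorem coeff_sphericalPolynomial_ne_zero (a : Fin N → ℕ) :
    (sphericalPolynomial μ a).coeff (Finsupp.equivFunOnFinite.symm (minorWeight a)) ≠ 0 := by
  rw [sphericalPolynomial, coeff_integralCoeff, (hasTopCoeff_minorPower a _ _).2]
  convert integral_minorPower_conjTranspose_mul_self_ne_zero (μ := μ) a using 3 with U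
  let ev : C(Matrix.unitaryGroup (Fin N) ℂ, ℂ) →+* ℂ :=
    (Pi.evalRingHom (fun _ => ℂ) U).comp ContinuousMap.coeFnRingHom
  change ev (_ * _) = _
  rw [map_mul, ← minorPower_map, ← minorPower_map, mul_comm]
  rfl

theorem sphericalPolynomial_ne_zero (a : Fin N → ℕ) : sphericalPolynomial μ a ≠ 0 := by
  intro h
  exact coeff_sphericalPolynomial_ne_zero (μ := μ) a (by rw [h, MvPolynomial.coeff_zero])

theorem degree_sphericalPolynomial (a : Fin N → ℕ) :
    MonomialOrder.lex.degree (sphericalPolynomial μ a) =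
      Finsupp.equivFunOnFinite.symm (minorWeight a) := by
  apply MonomialOrder.lex.toSyn.injective
  apply le_antisymm
  · rw [MonomialOrder.degree_le_iff]
    intro d hd
    by_contra hlt
    refine MvPolynomial.mem_support_iff.mp hd ?_
    rw [sphericalPolynomial, coeff_integralCoeff, MonomialOrder.coeff_eq_zero_of_lt
      (((hasTopCoeff_minorPower a _ _).1).trans_lt (not_le.mp hlt))]
    simp
  · exact MonomialOrder.le_degree
      (MvPolynomial.mem_support_iff.mpr (coeff_sphericalPolynomial_ne_zero a))

theorem isSymmetric_sphericalPolynomial [IsProbabilityMeasure μ] (a : Fin N → ℕ) :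
    (sphericalPolynomial μ a).IsSymmetric := by
  intro e
  refine MvPolynomial.funext fun x => ?_
  rw [MvPolynomial.eval_rename, eval_sphericalPolynomial, eval_sphericalPolynomial]
  let P : Matrix (Fin N) (Fin N) ℂ := (1 : Matrix (Fin N) (Fin N) ℂ).submatrix e id
  let P' : Matrix (Fin N) (Fin N) ℂ := (1 : Matrix (Fin N) (Fin N) ℂ).submatrix id e
  have h1 : Matrix.diagonal (x ∘ e) = P * (Matrix.diagonal x * P') := by
    ext i j
    simp only [P, P', Matrix.mul_apply, Matrix.diagonal_apply, Matrix.one_apply,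
      Matrix.submatrix_apply, id]
    simp only [ite_mul, mul_ite, one_mul, mul_one, zero_mul, mul_zero, Finset.sum_ite_eq,
      Finset.mem_univ, if_true, Function.comp_apply]
    split_ifs with h <;> simp [h]
  have h2 : P' * P = 1 := by
    ext i j
    rw [Matrix.mul_apply, ← e.symm.sum_comp]
    simp [P, P', Matrix.one_apply]
  rw [h1, sphericalFunction_mul_comm, Matrix.mul_assoc, h2, Matrix.mul_one]

/-- The spherical polynomials span the symmetric polynomials: subtract leading terms. -/
theorem mem_span_sphericalPolynomial [IsProbabilityMeasure μ] {g : MvPolynomial (Fin N) ℂ}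
    (hg : g.IsSymmetric) : g ∈ Submodule.span ℂ (Set.range (sphericalPolynomial μ)) := by
  generalize hd : MonomialOrder.lex.toSyn (MonomialOrder.lex.degree g) = d
  induction d using WellFoundedLT.induction generalizing g with
  | _ d ih =>
    subst hd
    by_cases hg0 : g = 0
    · rw [hg0]
      exact Submodule.zero_mem _
    obtain ⟨a, ha⟩ := exists_minorWeight_eq (antitone_degree_of_isSymmetric hg hg0)
    have hdeg : MonomialOrder.lex.degree (sphericalPolynomial μ a) =
        MonomialOrder.lex.degree g := by
      rw [degree_sphericalPolynomial, ha]
      exact Finsupp.equivFunOnFinite.symm_apply_apply _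
    set Φ := sphericalPolynomial μ a
    set b : ℂ := MonomialOrder.lex.leadingCoeff g / MonomialOrder.lex.leadingCoeff Φ
    have hmem : b • Φ ∈ Submodule.span ℂ (Set.range (sphericalPolynomial μ)) :=
      Submodule.smul_mem _ _ (Submodule.subset_span ⟨a, rfl⟩)
    have hsymm : (g - b • Φ).IsSymmetric := hg.sub ((isSymmetric_sphericalPolynomial a).smul b)
    by_cases h0 : g - b • Φ = 0
    · rw [sub_eq_zero.mp h0]
      exact hmem
    have hlt : MonomialOrder.lex.degree (g - b • Φ) ≺[MonomialOrder.lex]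
        MonomialOrder.lex.degree g := by
      refine lt_of_le_of_ne ?_ fun heq => ?_
      · refine MonomialOrder.degree_sub_le.trans (max_le le_rfl ?_)
        rw [← hdeg]
        exact MonomialOrder.degree_smul_le
      · have hc := (MonomialOrder.lex (σ := Fin N)).coeff_degree_ne_zero_iff.mpr h0
        have hΦ : MonomialOrder.lex.leadingCoeff Φ ≠ 0 :=
          MonomialOrder.leadingCoeff_ne_zero_iff.mpr (sphericalPolynomial_ne_zero a)
        have hΦc : Φ.coeff (MonomialOrder.lex.degree g) = MonomialOrder.lex.leadingCoeff Φ := by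
          rw [← hdeg]
          rfl
        rw [MonomialOrder.lex.toSyn.injective heq, MvPolynomial.coeff_sub,
          MvPolynomial.coeff_smul, hΦc, smul_eq_mul, div_mul_cancel₀ _ hΦ] at hc
        exact hc (sub_self _)
    have := Submodule.add_mem _ (ih _ hlt hsymm rfl) hmem
    rwa [sub_add_cancel] at this

end SphericalPolynomial

/-! ### Jacobi–Trudi determinants -/

section JacobiTrudi

/-- The Jacobi–Trudi matrix `h_{κ_i - i + j}` for a sequence `h`. -/
def jacobiTrudi {n : ℕ} {R : Type*} [CommRing R] (κ : Fin n → ℕ) (h : ℕ → R) :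
    Matrix (Fin n) (Fin n) R :=
  Matrix.of fun i j => if (i : ℕ) ≤ κ i + j then h (κ i + j - i) else 0

/-- The generating series `∏_r (1 - r T)⁻¹` of the complete homogeneous symmetric polynomials of the
elements of a multiset. -/
noncomputable def completeSeries (s : Multiset ℂ) : PowerSeries ℂ :=
  (s.map fun r => PowerSeries.mk fun m => r ^ m).prod

theorem eval_hsymm {σ : Type*} [Fintype σ] [DecidableEq σ] (x : σ → ℂ) (k : ℕ) :
    MvPolynomial.eval x (MvPolynomial.hsymm σ ℂ k) =
      PowerSeries.coeff k (completeSeries (Finset.univ.val.map x)) := by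
  rw [completeSeries, Multiset.map_map]
  change _ = PowerSeries.coeff k (∏ i : σ, PowerSeries.mk fun m => x i ^ m)
  rw [PowerSeries.coeff_prod, MvPolynomial.hsymm, map_sum]
  refine Finset.sum_nbij (fun s : Sym σ k => Multiset.toFinsupp s.1) ?_ ?_ ?_ ?_
  · intro s _
    rw [Finset.mem_finsuppAntidiag]
    refine ⟨?_, Finset.subset_univ _⟩
    conv_rhs => rw [← s.2]
    exact Multiset.sum_count_eq_card fun i _ => Finset.mem_univ i
  · intro s _ t _ h
    exact Sym.coe_injective (Multiset.toFinsupp.injective h)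
  · intro l hl
    rw [Finset.mem_coe, Finset.mem_finsuppAntidiag] at hl
    have hcard : (Finsupp.toMultiset l).card = k := by
      rw [Finsupp.card_toMultiset, ← hl.1]
      exact Finsupp.sum_fintype _ _ fun _ => rfl
    exact ⟨⟨Finsupp.toMultiset l, hcard⟩, Finset.mem_coe.mpr (Finset.mem_univ _), by simp⟩
  · intro s _
    rw [map_multiset_prod, Multiset.map_map]
    simp only [Function.comp_def, MvPolynomial.eval_X, PowerSeries.coeff_mk,
      Multiset.toFinsupp_apply]
    rw [Finset.prod_multiset_map_count]
    refine (Finset.prod_subset (Finset.subset_univ _) fun i _ hi => ?_)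
    rw [Multiset.count_eq_zero.mpr (by simpa using hi), pow_zero]

theorem coeff_zero_completeSeries (s : Multiset ℂ) :
    PowerSeries.coeff 0 (completeSeries s) = 1 := by
  rw [PowerSeries.coeff_zero_eq_constantCoeff_apply, completeSeries, map_multiset_prod,
    Multiset.map_map]
  refine Multiset.prod_eq_one fun r hr => ?_
  obtain ⟨z, -, rfl⟩ := Multiset.mem_map.mp hr
  simp [← PowerSeries.coeff_zero_eq_constantCoeff_apply]

/-- Rows of length zero at the bottom of the Jacobi–Trudi matrix do not change its determinant. -/
theorem det_jacobiTrudi_extend {ℓ n : ℕ} (hℓ : ℓ ≤ n) {R : Type*} [CommRing R] (κ : ℕ → ℕ)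
    (hκ : ∀ i, ℓ ≤ i → κ i = 0) {h : ℕ → R} (h0 : h 0 = 1) :
    (jacobiTrudi (fun i : Fin n => κ i) h).det = (jacobiTrudi (fun i : Fin ℓ => κ i) h).det := by
  rw [Matrix.twoBlockTriangular_det _ (fun i : Fin n => (i : ℕ) < ℓ)]
  · have h1 : ((jacobiTrudi (fun i : Fin n => κ i) h).toSquareBlockProp
        fun i => ¬ (i : ℕ) < ℓ).det = 1 := by
      rw [Matrix.det_of_isUpperTriangular]
      · refine Finset.prod_eq_one fun i _ => ?_
        simp [Matrix.toSquareBlockProp, jacobiTrudi, h0, hκ _ (not_lt.mp i.2)]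
      · intro i j hij
        have hij' : (j : Fin n) < (i : Fin n) := hij
        have : ¬ ((i : Fin n) : ℕ) ≤ ((j : Fin n) : ℕ) := not_le.mpr hij'
        simp [Matrix.toSquareBlockProp, jacobiTrudi, hκ _ (not_lt.mp i.2), this]
    rw [h1, mul_one]
    let e : Fin ℓ ≃ {i : Fin n // (i : ℕ) < ℓ} :=
      { toFun := fun i => ⟨Fin.castLE hℓ i, i.2⟩
        invFun := fun i => ⟨i.1, i.2⟩
        left_inv := fun i => rfl
        right_inv := fun i => rfl }
    rw [← Matrix.det_submatrix_equiv_self e]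
    rfl
  · intro i hi j hj
    have : ¬ (i : ℕ) ≤ (j : ℕ) := by omega
    simp [jacobiTrudi, hκ _ (not_lt.mp hi), this]

theorem det_jacobiTrudi_zero {n : ℕ} {R : Type*} [CommRing R] {h : ℕ → R} (h0 : h 0 = 1) :
    (jacobiTrudi (fun _ : Fin n => 0) h).det = 1 := by
  rw [det_jacobiTrudi_extend (ℓ := 0) (Nat.zero_le _) (fun _ => 0) (fun _ _ => rfl) h0,
    Matrix.det_isEmpty]

theorem eval_det_jacobiTrudi {σ : Type*} {n : ℕ} (κ : Fin n → ℕ) (x : σ → ℂ)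
    (h : ℕ → MvPolynomial σ ℂ) :
    MvPolynomial.eval x (jacobiTrudi κ h).det =
      (jacobiTrudi κ fun k => MvPolynomial.eval x (h k)).det := by
  rw [RingHom.map_det]
  congr 1
  ext i j
  simp only [jacobiTrudi, RingHom.mapMatrix_apply, Matrix.map_apply, Matrix.of_apply]
  split_ifs <;> simp

theorem one_sub_mul_mk_pow (r : ℂ) :
    (1 - PowerSeries.C r * PowerSeries.X) * (PowerSeries.mk fun m => r ^ m) = 1 := by
  ext m
  rw [sub_mul, one_mul, mul_assoc, map_sub, PowerSeries.coeff_C_mul]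
  cases m with
  | zero => simp
  | succ m => simp [PowerSeries.coeff_succ_X_mul, pow_succ', PowerSeries.coeff_one]

/-- The expansion `x_j ^ m = ∑ₗ h_{m - (N - 1) + l} e^{(j)}_{N - 1 - l}`, up to signs, where `e^{(j)}`
are the elementary symmetric polynomials in the variables other than `x_j`. Here `m` is
`κ i + (N - 1 - i)`. -/
theorem exists_jacobiTrudi_mul_eq_pow {N : ℕ} (x : Fin N → ℂ) :
    ∃ M : Matrix (Fin N) (Fin N) ℂ, ∀ κ : Fin N → ℕ,
      jacobiTrudi κ (fun k => PowerSeries.coeff k (completeSeries (Finset.univ.val.map x))) * M =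
        Matrix.of fun i j => x j ^ (κ i + (N - 1 - i)) := by
  let E : Fin N → Polynomial ℂ := fun j =>
    ∏ i ∈ Finset.univ.erase j, (1 - Polynomial.C (x i) * Polynomial.X)
  have hE : ∀ j, (E j).natDegree < N := by
    intro j
    have h1 : (E j).natDegree ≤ ∑ i ∈ Finset.univ.erase j, 1 := by
      refine (Polynomial.natDegree_prod_le _ _).trans (Finset.sum_le_sum fun i _ => ?_)
      compute_degree
    have h2 : 0 < N := j.pos
    rw [Finset.sum_const, Finset.card_erase_of_mem (Finset.mem_univ _), Finset.card_univ,
      Fintype.card_fin] at h1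
    simp only [smul_eq_mul, mul_one] at h1
    omega
  have hEG : ∀ j, (E j : PowerSeries ℂ) * completeSeries (Finset.univ.val.map x) =
      PowerSeries.mk fun m => x j ^ m := by
    intro j
    have h1 : completeSeries (Finset.univ.val.map x) =
        (PowerSeries.mk fun m => x j ^ m) *
          ∏ i ∈ Finset.univ.erase j, PowerSeries.mk fun m => x i ^ m := by
      rw [Finset.mul_prod_erase Finset.univ (fun i => PowerSeries.mk fun m => x i ^ m)
        (Finset.mem_univ j), completeSeries, Multiset.map_map]
      rfl
    have h2 : (E j : PowerSeries ℂ) =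
        ∏ i ∈ Finset.univ.erase j, (1 - PowerSeries.C (x i) * PowerSeries.X) := by
      simp only [E, ← Polynomial.coeToPowerSeries.ringHom_apply, map_prod, map_sub, map_one,
        map_mul]
      simp
    rw [h1, h2, mul_left_comm, ← Finset.prod_mul_distrib,
      Finset.prod_eq_one fun i _ => one_sub_mul_mk_pow (x i), mul_one]
  refine ⟨Matrix.of fun l j => (E j).coeff (N - 1 - l), fun κ => ?_⟩
  ext i j
  set m := κ i + (N - 1 - i) with hm
  have h1 := congrArg (PowerSeries.coeff m) (hEG j)
  rw [PowerSeries.coeff_mk, PowerSeries.coeff_mul,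
    Finset.Nat.sum_antidiagonal_eq_sum_range_succ_mk] at h1
  rw [Matrix.of_apply, ← h1, Matrix.mul_apply]
  let F : ℕ → ℂ := fun r => if r ≤ m then
    (E j).coeff r * PowerSeries.coeff (m - r) (completeSeries (Finset.univ.val.map x)) else 0
  have hi := i.2
  have h2 : ∀ l : Fin N, jacobiTrudi κ (fun k => PowerSeries.coeff k
      (completeSeries (Finset.univ.val.map x))) i l * (E j).coeff (N - 1 - l) =
      F (N - 1 - l) := by
    intro l
    have hl := l.2
    simp only [jacobiTrudi, Matrix.of_apply, F]
    by_cases hc : (i : ℕ) ≤ κ i + l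
    · rw [if_pos hc, if_pos (by omega), mul_comm]
      congr 3
      omega
    · rw [if_neg hc, if_neg (by omega), zero_mul]
  simp only [Matrix.of_apply, h2]
  rw [Fin.sum_univ_eq_sum_range (fun l => F (N - 1 - l)) N, Finset.sum_range_reflect F N]
  have h3 : ∑ r ∈ Finset.range N, F r = ∑ r ∈ Finset.range (N + m + 1), F r := by
    refine Finset.sum_subset (Finset.range_mono (by omega)) fun r _ hr => ?_
    have hr' : (E j).natDegree < r := (hE j).trans_le (by simpa using hr)
    simp [F, Polynomial.coeff_eq_zero_of_natDegree_lt hr']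
  have h4 : ∑ r ∈ Finset.range (m + 1), F r = ∑ r ∈ Finset.range (N + m + 1), F r := by
    refine Finset.sum_subset (Finset.range_mono (by omega)) fun r _ hr => ?_
    have hr' : ¬ r ≤ m := by simpa using hr
    simp [F, hr']
  rw [h3, ← h4]
  refine Finset.sum_congr rfl fun r hr => ?_
  have hr' : r ≤ m := by simpa [Nat.lt_succ_iff] using hr
  simp [F, hr']

/-- The alternant `det (x_j ^ (l_i))`. -/
noncomputable def alternant {N : ℕ} (l : Fin N → ℕ) : MvPolynomial (Fin N) ℂ :=
  (Matrix.of fun i j => MvPolynomial.X j ^ l i).det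

/-- The bialternant formula. -/
theorem det_jacobiTrudi_hsymm_mul_alternant {N : ℕ} (κ : Fin N → ℕ) :
    (jacobiTrudi κ (MvPolynomial.hsymm (Fin N) ℂ)).det * alternant (fun i : Fin N => N - 1 - i) =
      alternant fun i => κ i + (N - 1 - i) := by
  refine MvPolynomial.funext fun x => ?_
  obtain ⟨M, hM⟩ := exists_jacobiTrudi_mul_eq_pow x
  have halt : ∀ l : Fin N → ℕ, MvPolynomial.eval x (alternant l) =
      (Matrix.of fun i j => x j ^ l i).det := by
    intro l
    rw [alternant, RingHom.map_det]
    congr 1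
    ext i j
    simp
  have h0 := congrArg Matrix.det (hM fun _ => 0)
  rw [Matrix.det_mul, det_jacobiTrudi_zero (coeff_zero_completeSeries _), one_mul] at h0
  rw [map_mul, eval_det_jacobiTrudi, halt, halt, ← hM κ, Matrix.det_mul, h0]
  simp only [eval_hsymm, zero_add]

open scoped MonomialOrder

theorem hasTopCoeff_alternant {N : ℕ} {l : Fin N → ℕ} (hl : StrictAnti l) :
    HasTopCoeff (alternant l) (Finsupp.equivFunOnFinite.symm l) 1 := by
  classical
  have hexp : alternant l = ∑ σ : Equiv.Perm (Fin N),
      MvPolynomial.monomial (Finsupp.equivFunOnFinite.symm (l ∘ σ))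
        (((Equiv.Perm.sign σ : ℤˣ) : ℤ) : ℂ) := by
    rw [alternant, Matrix.det_apply']
    refine Finset.sum_congr rfl fun σ _ => ?_
    rw [MvPolynomial.monomial_eq, Finsupp.prod_fintype _ _ (by simp)]
    simp
  constructor
  · rw [hexp]
    refine MonomialOrder.degree_sum_le.trans (Finset.sup_le fun σ _ => ?_)
    refine (MonomialOrder.degree_monomial_le _).trans ?_
    by_contra! hlt
    obtain ⟨j, hj, hlt⟩ := lex_lt_iff_exists.mp hlt
    have h1 : σ j < j := hl.lt_iff_gt.mp hlt
    have h2 : σ j = σ (σ j) := hl.injective (hj _ h1)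
    exact h1.ne (σ.injective h2).symm
  · rw [hexp, MvPolynomial.coeff_sum, Finset.sum_eq_single 1]
    · simp
    · intro σ _ hσ
      rw [MvPolynomial.coeff_monomial, if_neg]
      intro h
      refine hσ (Equiv.ext fun i => hl.injective ?_)
      exact congrFun (Finsupp.equivFunOnFinite.symm.injective h) i
    · simp

theorem degree_alternant {N : ℕ} {l : Fin N → ℕ} (hl : StrictAnti l) :
    alternant l ≠ 0 ∧
      MonomialOrder.lex.degree (alternant l) = Finsupp.equivFunOnFinite.symm l := by
  obtain ⟨h1, h2⟩ := hasTopCoeff_alternant hl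
  refine ⟨fun h => by simp [h] at h2, MonomialOrder.lex.toSyn.injective (h1.antisymm ?_)⟩
  exact MonomialOrder.le_degree (MvPolynomial.mem_support_iff.mpr (by rw [h2]; exact one_ne_zero))

/-- The leading monomial of a Schur polynomial is `x ^ κ`, by the bialternant formula. -/
theorem degree_det_jacobiTrudi {N : ℕ} {κ : Fin N → ℕ} (hκ : Antitone κ) :
    (jacobiTrudi κ (MvPolynomial.hsymm (Fin N) ℂ)).det ≠ 0 ∧
      MonomialOrder.lex.degree (jacobiTrudi κ (MvPolynomial.hsymm (Fin N) ℂ)).det =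
        Finsupp.equivFunOnFinite.symm κ := by
  have hδ : StrictAnti fun i : Fin N => N - 1 - (i : ℕ) := fun i j hij => by
    have := Fin.lt_def.mp hij
    have := j.2
    beta_reduce
    omega
  have hκδ : StrictAnti fun i : Fin N => κ i + (N - 1 - (i : ℕ)) :=
    hκ.add_strictAnti hδ
  have h := det_jacobiTrudi_hsymm_mul_alternant κ
  obtain ⟨h1, h2⟩ := degree_alternant hδ
  obtain ⟨h3, h4⟩ := degree_alternant hκδ
  have h5 : (jacobiTrudi κ (MvPolynomial.hsymm (Fin N) ℂ)).det ≠ 0 :=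
    left_ne_zero_of_mul (h ▸ h3)
  refine ⟨h5, ?_⟩
  have h6 := MonomialOrder.lex.degree_mul h5 h1
  rw [h, h2, h4] at h6
  refine add_right_cancel (b := Finsupp.equivFunOnFinite.symm fun i : Fin N => N - 1 - (i : ℕ)) ?_
  rw [← h6]
  ext i
  simp

end JacobiTrudi

/-! ### Schur polynomials of matrices -/

section MatrixSchur

theorem isSymmetric_det_jacobiTrudi {N : ℕ} (κ : Fin N → ℕ) :
    (jacobiTrudi κ (MvPolynomial.hsymm (Fin N) ℂ)).det.IsSymmetric := by
  intro e
  rw [AlgHom.map_det]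
  congr 1
  ext1 i j
  simp only [jacobiTrudi, AlgHom.mapMatrix_apply, Matrix.map_apply, Matrix.of_apply]
  split_ifs
  · exact MvPolynomial.rename_hsymm _ _ _ e
  · exact map_zero _

variable {N : ℕ}

theorem matrixSchur_eq_det {lam : YoungDiagram} (hlam : lam.colLen 0 ≤ N)
    (X : Matrix (Fin N) (Fin N) ℂ) :
    matrixSchur lam X = (jacobiTrudi (fun i : Fin N => lam.rowLen i)
      fun k => PowerSeries.coeff k (completeSeries X.charpoly.roots)).det := by
  classical
  rw [det_jacobiTrudi_extend hlam lam.rowLen _ (coeff_zero_completeSeries _)]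
  · have h := eval_det_jacobiTrudi (fun i : Fin (lam.colLen 0) => lam.rowLen i)
      (fun x : X.charpoly.roots.ToType => x.1) (MvPolynomial.hsymm X.charpoly.roots.ToType ℂ)
    simp only [eval_hsymm, Multiset.map_univ_coe] at h
    rw [← h]
    simp only [matrixSchur, schurPolynomial, jacobiTrudi]
  · intro i hi
    by_contra h0
    have h1 : (i, 0) ∈ lam := YoungDiagram.mem_iff_lt_rowLen.mpr (Nat.pos_of_ne_zero h0)
    exact (YoungDiagram.mem_iff_lt_colLen.mp h1).not_ge hi

theorem completeSeries_mul_charpolyRev (X : Matrix (Fin N) (Fin N) ℂ) :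
    completeSeries X.charpoly.roots * (X.charpolyRev : PowerSeries ℂ) = 1 := by
  have h1 : X.charpolyRev =
      (X.charpoly.roots.map fun r => 1 - Polynomial.C r * Polynomial.X).prod := by
    rw [← Matrix.reverse_charpoly]
    conv_lhs => rw [(IsAlgClosed.splits X.charpoly).eq_prod_roots_of_monic X.charpoly_monic]
    generalize X.charpoly.roots = s
    induction s using Multiset.induction_on with
    | empty => simpa using Polynomial.reverse_C (1 : ℂ)
    | cons r s ih =>
      rw [Multiset.map_cons, Multiset.prod_cons, Polynomial.reverse_mul_of_domain, ih,
        Multiset.map_cons, Multiset.prod_cons]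
      congr 1
      rw [Polynomial.reverse, Polynomial.natDegree_X_sub_C, Polynomial.reflect_sub,
        Polynomial.reflect_C, pow_one]
      congr 1
      exact Polynomial.reflect_one_X
  rw [h1, completeSeries, ← Polynomial.coeToPowerSeries.ringHom_apply, map_multiset_prod,
    Multiset.map_map, ← Multiset.prod_map_mul]
  refine Multiset.prod_eq_one fun p hp => ?_
  obtain ⟨r, -, rfl⟩ := Multiset.mem_map.mp hp
  rw [mul_comm]
  simpa using one_sub_mul_mk_pow r

/-- The complete homogeneous symmetric polynomials of the eigenvalues are polynomials in the
entries of the matrix: their generating series is the inverse of `det (1 - T X)`. -/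
theorem isPolyFunction_coeff_completeSeries :
    ∃ H : ℕ → MvPolynomial (Fin N × Fin N) ℂ, ∀ k (X : Matrix (Fin N) (Fin N) ℂ),
      PowerSeries.coeff k (completeSeries X.charpoly.roots) =
        MvPolynomial.eval (fun p => X p.1 p.2) (H k) := by
  let M : Matrix (Fin N) (Fin N) (MvPolynomial (Fin N × Fin N) ℂ) :=
    Matrix.of fun i j => MvPolynomial.X (i, j)
  let D : PowerSeries (MvPolynomial (Fin N × Fin N) ℂ) := (M.charpolyRev : PowerSeries _)
  have hD : D * PowerSeries.invOfUnit D 1 = 1 := by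
    refine PowerSeries.mul_invOfUnit D 1 ?_
    simp [D, Polynomial.coeff_zero_eq_eval_zero]
  refine ⟨fun k => PowerSeries.coeff k (PowerSeries.invOfUnit D 1), fun k X => ?_⟩
  let ev := MvPolynomial.eval (R := ℂ) fun p : Fin N × Fin N => X p.1 p.2
  have h1 : PowerSeries.map ev D = (X.charpolyRev : PowerSeries ℂ) := by
    rw [← Polynomial.polynomial_map_coe]
    congr 1
    rw [Matrix.charpolyRev, Matrix.charpolyRev, ← Polynomial.coe_mapRingHom, RingHom.map_det]
    congr 1
    ext i j
    simp [M, ev, Matrix.one_apply, apply_ite]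
  have h2 := congrArg (PowerSeries.map ev) hD
  rw [map_mul, map_one, h1] at h2
  have h3 : completeSeries X.charpoly.roots = PowerSeries.map ev (PowerSeries.invOfUnit D 1) := by
    calc _ = completeSeries X.charpoly.roots * ((X.charpolyRev : PowerSeries ℂ) *
          PowerSeries.map ev (PowerSeries.invOfUnit D 1)) := by rw [h2, mul_one]
      _ = _ := by rw [← mul_assoc, completeSeries_mul_charpolyRev, one_mul]
  rw [h3, PowerSeries.coeff_map]

theorem isPolyFunction_matrixSchur {lam : YoungDiagram} (hlam : lam.colLen 0 ≤ N) :
    IsPolyFunction (matrixSchur lam : Matrix (Fin N) (Fin N) ℂ → ℂ) := by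
  obtain ⟨H, hH⟩ := isPolyFunction_coeff_completeSeries (N := N)
  refine ⟨(jacobiTrudi (fun i : Fin N => lam.rowLen i) H).det, fun X => ?_⟩
  rw [matrixSchur_eq_det hlam, eval_det_jacobiTrudi]
  simp only [hH]

end MatrixSchur

/-! ### Traces on symmetric powers -/

section SymmetricPower

variable {N : ℕ} {R : Type*} [CommRing R]

/-- The entry of the `k`-th symmetric power of `X` at the monomials `y ^ β` and `y ^ γ` of
degree `k`: the coefficient of `y ^ γ` in `(X y) ^ β`. -/
noncomputable def symPowerEntry (X : Matrix (Fin N) (Fin N) R) (β γ : Fin N →₀ ℕ) : R :=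
  (MvPolynomial.aeval (fun i => ∑ j, MvPolynomial.C (X i j) * MvPolynomial.X j)
    (MvPolynomial.monomial β (1 : R)) : MvPolynomial (Fin N) R).coeff γ

/-- The exponents of the monomials of degree `k`. -/
noncomputable def monomialsOfDegree (N k : ℕ) : Finset (Fin N →₀ ℕ) :=
  Finset.univ.finsuppAntidiag k

theorem mem_monomialsOfDegree {k : ℕ} {γ : Fin N →₀ ℕ} :
    γ ∈ monomialsOfDegree N k ↔ ∑ i, γ i = k := by
  simp [monomialsOfDegree, Finset.mem_finsuppAntidiag]

theorem aeval_linear_monomial_eq_sum (X : Matrix (Fin N) (Fin N) R) {k : ℕ} {β : Fin N →₀ ℕ}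
    (hβ : β ∈ monomialsOfDegree N k) :
    (MvPolynomial.aeval (fun i => ∑ j, MvPolynomial.C (X i j) * MvPolynomial.X j)
      (MvPolynomial.monomial β (1 : R)) : MvPolynomial (Fin N) R) =
      ∑ γ ∈ monomialsOfDegree N k, MvPolynomial.monomial γ (symPowerEntry X β γ) := by
  have hhom : (MvPolynomial.aeval (fun i => ∑ j, MvPolynomial.C (X i j) * MvPolynomial.X j)
      (MvPolynomial.monomial β (1 : R)) : MvPolynomial (Fin N) R).IsHomogeneous k := by
    rw [MvPolynomial.aeval_monomial, map_one, one_mul, Finsupp.prod_fintype _ _ (by simp),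
      ← mem_monomialsOfDegree.mp hβ]
    refine MvPolynomial.IsHomogeneous.prod _ _ _ fun i _ => ?_
    have : (∑ j, MvPolynomial.C (X i j) * MvPolynomial.X j :
        MvPolynomial (Fin N) R).IsHomogeneous 1 :=
      MvPolynomial.IsHomogeneous.sum _ _ _ fun j _ => by
        simpa using (MvPolynomial.isHomogeneous_C (Fin N) (X i j)).mul
          (MvPolynomial.isHomogeneous_X R j)
    simpa using this.pow (β i)
  ext γ
  rw [MvPolynomial.coeff_sum]
  simp only [MvPolynomial.coeff_monomial]
  rw [Finset.sum_ite_eq']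
  split_ifs with h
  · rfl
  · by_contra hne
    refine h (mem_monomialsOfDegree.mpr ?_)
    rw [← hhom hne, Finsupp.weight_apply]
    simp [Finsupp.sum_fintype]

theorem symPowerEntry_mul (X Y : Matrix (Fin N) (Fin N) R) {k : ℕ} {β : Fin N →₀ ℕ}
    (hβ : β ∈ monomialsOfDegree N k) (δ : Fin N →₀ ℕ) :
    symPowerEntry (X * Y) β δ =
      ∑ γ ∈ monomialsOfDegree N k, symPowerEntry X β γ * symPowerEntry Y γ δ := by
  have h1 : ∀ p : MvPolynomial (Fin N) R,
      MvPolynomial.aeval (fun i => ∑ j, MvPolynomial.C ((X * Y) i j) * MvPolynomial.X j) p =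
      MvPolynomial.aeval (fun i => ∑ j, MvPolynomial.C (Y i j) * MvPolynomial.X j)
        (MvPolynomial.aeval (fun i => ∑ j, MvPolynomial.C (X i j) * MvPolynomial.X j) p) := by
    intro p
    rw [← AlgHom.comp_apply]
    congr 1
    refine MvPolynomial.algHom_ext fun i => ?_
    simp only [MvPolynomial.aeval_X, AlgHom.comp_apply, map_sum, map_mul, Matrix.mul_apply]
    simp only [← MvPolynomial.algebraMap_eq, AlgHom.commutes]
    simp only [Finset.sum_mul, Finset.mul_sum]
    rw [Finset.sum_comm]
    exact Finset.sum_congr rfl fun l _ => Finset.sum_congr rfl fun j _ => mul_assoc _ _ _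
  rw [symPowerEntry, h1, aeval_linear_monomial_eq_sum X hβ, map_sum, MvPolynomial.coeff_sum]
  refine Finset.sum_congr rfl fun γ _ => ?_
  rw [symPowerEntry, symPowerEntry, ← MvPolynomial.coeff_C_mul, ← MvPolynomial.algebraMap_eq,
    ← Algebra.smul_def, ← map_smul, MvPolynomial.smul_monomial, smul_eq_mul, mul_one]

theorem symPowerEntry_map {S : Type*} [CommRing S] (φ : R →+* S) (X : Matrix (Fin N) (Fin N) R)
    (β γ : Fin N →₀ ℕ) : symPowerEntry (X.map φ) β γ = φ (symPowerEntry X β γ) := by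
  rw [symPowerEntry, symPowerEntry, ← MvPolynomial.coeff_map, MvPolynomial.aeval_monomial,
    MvPolynomial.aeval_monomial, map_one, one_mul, map_one, one_mul,
    Finsupp.prod_fintype _ _ (by simp), Finsupp.prod_fintype _ _ (by simp)]
  simp

theorem isPolyFunction_symPowerEntry (β γ : Fin N →₀ ℕ) :
    IsPolyFunction fun X : Matrix (Fin N) (Fin N) ℂ => symPowerEntry X β γ := by
  refine ⟨symPowerEntry (Matrix.of fun i j => MvPolynomial.X (i, j)) β γ, fun X => ?_⟩
  rw [← symPowerEntry_map]
  congr 1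
  ext i j
  simp

theorem symPowerEntry_diagonal (d : Fin N → R) (β : Fin N →₀ ℕ) :
    symPowerEntry (Matrix.diagonal d) β β = ∏ i, d i ^ β i := by
  rw [symPowerEntry, MvPolynomial.aeval_monomial, map_one, one_mul,
    Finsupp.prod_fintype _ _ (by simp)]
  have h1 : ∀ i, ∑ j, MvPolynomial.C (Matrix.diagonal d i j) * MvPolynomial.X j =
      (MvPolynomial.C (d i) * MvPolynomial.X i : MvPolynomial (Fin N) R) := by
    intro i
    rw [Finset.sum_eq_single i]
    · rw [Matrix.diagonal_apply_eq]
    · intro j _ hj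
      rw [Matrix.diagonal_apply_ne _ hj.symm, map_zero, zero_mul]
    · simp
  simp only [h1, mul_pow, Finset.prod_mul_distrib, ← map_pow]
  rw [← map_prod, MvPolynomial.coeff_C_mul]
  have h2 : (∏ i, MvPolynomial.X i ^ β i : MvPolynomial (Fin N) R) = MvPolynomial.monomial β 1 := by
    rw [MvPolynomial.monomial_eq, map_one, one_mul, Finsupp.prod_fintype _ _ (by simp)]
  rw [h2, MvPolynomial.coeff_monomial, if_pos rfl, mul_one]

theorem trace_symPower_conj (X Y D : Matrix (Fin N) (Fin N) R) (hYX : Y * X = 1) (k : ℕ) :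
    ∑ β ∈ monomialsOfDegree N k, symPowerEntry (X * D * Y) β β =
      ∑ β ∈ monomialsOfDegree N k, symPowerEntry D β β := by
  have h : ∀ P Q : Matrix (Fin N) (Fin N) R,
      ∑ β ∈ monomialsOfDegree N k, symPowerEntry (P * Q) β β =
        ∑ β ∈ monomialsOfDegree N k, symPowerEntry (Q * P) β β := by
    intro P Q
    rw [Finset.sum_congr rfl fun β hβ => symPowerEntry_mul P Q hβ β,
      Finset.sum_congr rfl fun β hβ => symPowerEntry_mul Q P hβ β, Finset.sum_comm]
    exact Finset.sum_congr rfl fun _ _ => Finset.sum_congr rfl fun _ _ => mul_comm _ _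
  rw [h, ← Matrix.mul_assoc, hYX, Matrix.one_mul]

theorem roots_charpoly_diagonal (d : Fin N → ℂ) :
    (Matrix.diagonal d).charpoly.roots = Finset.univ.val.map d := by
  rw [Matrix.charpoly_diagonal]
  exact Polynomial.roots_multiset_prod_X_sub_C (Finset.univ.val.map d) ▸ by
    rw [Multiset.map_map]; rfl

theorem charpoly_conj_diagonal (U : Matrix.unitaryGroup (Fin N) ℂ) (d : Fin N → ℂ) :
    (U * Matrix.diagonal d * (U : Matrix (Fin N) (Fin N) ℂ)ᴴ).charpoly =
      (Matrix.diagonal d).charpoly := by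
  rw [Matrix.charpoly_mul_comm, ← Matrix.mul_assoc, conjTranspose_mul_self_unitary,
    Matrix.one_mul]

/-- The complete homogeneous symmetric polynomial of the eigenvalues of `X` is the trace of a
symmetric power of `X`. -/
theorem coeff_completeSeries_eq_trace (k : ℕ) (X : Matrix (Fin N) (Fin N) ℂ) :
    PowerSeries.coeff k (completeSeries X.charpoly.roots) =
      ∑ β ∈ monomialsOfDegree N k, symPowerEntry X β β := by
  obtain ⟨H, hH⟩ := isPolyFunction_coeff_completeSeries (N := N)
  refine congrFun (IsPolyFunction.ext_conj_diagonal
    (f := fun X => PowerSeries.coeff k (completeSeries X.charpoly.roots))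
    (g := fun X => ∑ β ∈ monomialsOfDegree N k, symPowerEntry X β β) ⟨H k, hH k⟩ ?_
    fun U d => ?_) X
  · choose P hP using fun β : Fin N →₀ ℕ => isPolyFunction_symPowerEntry β β
    exact ⟨∑ β ∈ monomialsOfDegree N k, P β, fun X => by simp only [hP, map_sum]⟩
  · rw [charpoly_conj_diagonal, trace_symPower_conj _ _ _ (conjTranspose_mul_self_unitary U),
      roots_charpoly_diagonal, completeSeries, Multiset.map_map]
    change PowerSeries.coeff k (∏ i : Fin N, PowerSeries.mk fun m => d i ^ m) = _
    rw [PowerSeries.coeff_prod]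
    simp only [symPowerEntry_diagonal, PowerSeries.coeff_mk]
    rfl

end SymmetricPower

/-! ### Dominance of the weights occurring in a Schur polynomial -/

section Dominance

variable {N : ℕ}

/-- The monomial in the entries of `Z` in which column `i` has exponents `β i`. -/
def columnMonomial (β : Fin N → Fin N →₀ ℕ) (Z : Matrix (Fin N) (Fin N) ℂ) : ℂ :=
  ∏ i, ∏ j, Z j i ^ β i j

theorem isPolyFunction_columnMonomial (β : Fin N → Fin N →₀ ℕ) :
    IsPolyFunction (columnMonomial β) :=
  ⟨∏ i, ∏ j, MvPolynomial.X (j, i) ^ β i j, fun Z => by simp [columnMonomial]⟩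

theorem columnMonomial_mul_diagonal (β : Fin N → Fin N →₀ ℕ) (Z : Matrix (Fin N) (Fin N) ℂ)
    (s : Fin N → ℂ) :
    columnMonomial β (Z * Matrix.diagonal s) = columnMonomial β Z * ∏ i, s i ^ ∑ j, β i j := by
  simp only [columnMonomial, Matrix.mul_diagonal, mul_pow, Finset.prod_mul_distrib,
    Finset.prod_pow_eq_pow_sum]

theorem columnMonomial_mul_eq_sum (β : Fin N → Fin N →₀ ℕ) (X v : Matrix (Fin N) (Fin N) ℂ) :
    columnMonomial β (X * v) =
      ∑ γ ∈ Fintype.piFinset fun i => monomialsOfDegree N (∑ j, β i j),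
        (∏ i, symPowerEntry X (β i) (γ i)) * ∏ i, ∏ j, v j i ^ γ i j := by
  have h1 : ∀ i, ∏ j, (X * v) j i ^ β i j = ∑ γ ∈ monomialsOfDegree N (∑ j, β i j),
      symPowerEntry X (β i) γ * ∏ j, v j i ^ γ j := by
    intro i
    have h := congrArg (MvPolynomial.eval fun j => v j i) (aeval_linear_monomial_eq_sum X
      (mem_monomialsOfDegree.mpr (rfl : ∑ j, β i j = _)))
    rw [map_sum, eval_aeval, MvPolynomial.eval_monomial, one_mul,
      Finsupp.prod_fintype _ _ (by simp)] at h
    simp only [map_sum, map_mul, MvPolynomial.eval_C, MvPolynomial.eval_X,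
      MvPolynomial.eval_monomial] at h
    simp only [Matrix.mul_apply]
    rw [h]
    exact Finset.sum_congr rfl fun γ _ => by rw [Finsupp.prod_fintype _ _ (by simp)]
  simp only [columnMonomial, h1, Finset.prod_univ_sum, Finset.prod_mul_distrib]

theorem sum_le_sum_perm (σ : Equiv.Perm (Fin N)) (k : Fin N) :
    ∑ i with i ≤ k, (i : ℕ) ≤ ∑ i with i ≤ k, (σ i : ℕ) := by
  let S : Finset (Fin N) := Finset.univ.filter (· ≤ k)
  let T : Finset (Fin N) := S.map σ.toEmbedding
  have hT : ∑ i ∈ S, (σ i : ℕ) = ∑ i ∈ T, (i : ℕ) := by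
    rw [Finset.sum_map]
    rfl
  have hcard : (S \ T).card = (T \ S).card :=
    Finset.card_sdiff_comm (Finset.card_map _).symm
  change ∑ i ∈ S, (i : ℕ) ≤ ∑ i ∈ S, (σ i : ℕ)
  rw [hT, ← Finset.sum_inter_add_sum_sdiff S T, ← Finset.sum_inter_add_sum_sdiff T S,
    Finset.inter_comm T S]
  refine Nat.add_le_add_left ?_ _
  calc ∑ i ∈ S \ T, (i : ℕ) ≤ (S \ T).card • (k : ℕ) :=
        Finset.sum_le_card_nsmul _ _ _ fun i hi =>
          (Finset.mem_filter.mp (Finset.mem_sdiff.mp hi).1).2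
    _ = (T \ S).card • (k : ℕ) := by rw [hcard]
    _ ≤ ∑ i ∈ T \ S, (i : ℕ) := Finset.card_nsmul_le_sum _ _ _ fun i hi => by
        have h : ¬ i ≤ k := fun h =>
          (Finset.mem_sdiff.mp hi).2 (Finset.mem_filter.mpr ⟨Finset.mem_univ _, h⟩)
        exact (not_le.mp h).le

theorem continuous_coeff_completeSeries (m : ℕ) :
    Continuous fun U : Matrix.unitaryGroup (Fin N) ℂ => PowerSeries.coeff m
      (completeSeries (U : Matrix (Fin N) (Fin N) ℂ)ᴴ.charpoly.roots) := by
  obtain ⟨H, hH⟩ := isPolyFunction_coeff_completeSeries (N := N)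
  exact (IsPolyFunction.continuous (f := fun X => PowerSeries.coeff m
    (completeSeries X.charpoly.roots)) ⟨H m, hH m⟩).comp continuous_conjTranspose_unitary

variable [MeasurableSpace (Matrix.unitaryGroup (Fin N) ℂ)]
  [BorelSpace (Matrix.unitaryGroup (Fin N) ℂ)]
  {μ : Measure (Matrix.unitaryGroup (Fin N) ℂ)} [μ.IsHaarMeasure]

/-- A polynomial in the columns of `v` that has weight `minorWeight c` for left multiplication by
lower triangular matrices and multidegree `α` in the columns vanishes unless `minorWeight c`
dominates `α`: by elimination one may take `v` upper unitriangular, and conjugation by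
`diag(t, …, t, 1, …, 1)` then contracts `v` while scaling by a negative power of `t`. -/
theorem integral_columnMonomial_eq_zero (β : Fin N → Fin N →₀ ℕ) (c : Fin N → ℕ) {k : Fin N}
    (hk : ∑ i with i ≤ k, minorWeight c i < ∑ i with i ≤ k, ∑ j, β i j)
    (v : Matrix (Fin N) (Fin N) ℂ) :
    ∫ U : Matrix.unitaryGroup (Fin N) ℂ,
      columnMonomial β ((U : Matrix (Fin N) (Fin N) ℂ)ᴴ * v) *
        minorPower c (U : Matrix (Fin N) (Fin N) ℂ) ∂μ = 0 := by
  have hp := isPolyFunction_minorPower (N := N) c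
  have hq := isPolyFunction_columnMonomial β
  set J : Matrix (Fin N) (Fin N) ℂ → ℂ := fun v => ∫ U : Matrix.unitaryGroup (Fin N) ℂ,
      columnMonomial β ((U : Matrix (Fin N) (Fin N) ℂ)ᴴ * v) *
        minorPower c (U : Matrix (Fin N) (Fin N) ℂ) ∂μ with hJ
  have hJc : Continuous J := (IsPolyFamily.integral μ (IsPolyFamily.mul
    (hq.comp (.mul (.const continuous_conjTranspose_unitary) .id))
    (.const (hp.continuous.comp continuous_coe_unitary)))).continuous
  have hleft : ∀ L : Matrix (Fin N) (Fin N) ℂ, (∀ i j, i < j → L i j = 0) → ∀ v,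
      J (L * v) = minorPower c L * J v := by
    intro L hL v
    rw [hJ]
    beta_reduce
    rw [integral_translate_mul hp hq, ← integral_const_mul]
    refine integral_congr_ae (.of_forall fun U => ?_)
    simp only [minorPower_mul_left c hL]
    ring
  have hright : ∀ (s : Fin N → ℂ) v,
      J (v * Matrix.diagonal s) = J v * ∏ i, s i ^ ∑ j, β i j := by
    intro s v
    rw [hJ]
    beta_reduce
    rw [← integral_mul_const]
    refine integral_congr_ae (.of_forall fun U => ?_)
    simp only [← Matrix.mul_assoc, columnMonomial_mul_diagonal]
    ring
  refine congrFun (ext_of_leadingMinor_ne_zero hJc (g := fun _ => 0) continuous_const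
    fun v hv => ?_) v
  obtain ⟨L, hL, hT, hT1⟩ := exists_lower_mul_eq_unitriangular hv
  have h1 : minorPower c L * minorPower c v = 1 := by
    rw [← minorPower_mul_left c hL, minorPower_of_upper c hT]
    simp [hT1]
  suffices h : J (L * v) = 0 by
    rw [hleft L hL] at h
    exact (mul_eq_zero.mp h).resolve_left (left_ne_zero_of_mul_eq_one h1)
  generalize L * v = T at hT
  let s : ℂ → Fin N → ℂ := fun t i => if i ≤ k then t else 1
  let T' : ℂ → Matrix (Fin N) (Fin N) ℂ := fun t =>
    Matrix.of fun i j => T i j * if i ≤ k ∧ ¬ j ≤ k then t else 1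
  have hcomm : ∀ t, Matrix.diagonal (s t) * T = T' t * Matrix.diagonal (s t) := by
    intro t
    ext i j
    rw [Matrix.diagonal_mul, Matrix.mul_diagonal]
    simp only [s, T', Matrix.of_apply]
    by_cases hi : i ≤ k <;> by_cases hj : j ≤ k
    · simp [hi, hj, mul_comm]
    · simp [hi, hj, mul_comm]
    · rw [hT i j (hj.trans_lt (not_le.mp hi))]
      simp
    · simp [hi, hj]
  have hs : ∀ (t : ℂ) (w : Fin N → ℕ), ∏ i, s t i ^ w i = t ^ ∑ i with i ≤ k, w i := by
    intro t w
    rw [← Finset.prod_pow_eq_pow_sum, Finset.prod_filter]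
    refine Finset.prod_congr rfl fun i _ => ?_
    simp only [s]
    split_ifs <;> simp
  have hscale : ∀ t : ℂ, t ^ (∑ i with i ≤ k, minorWeight c i) * J T =
      J (T' t) * t ^ ∑ i with i ≤ k, ∑ j, β i j := by
    intro t
    have := congrArg J (hcomm t)
    rwa [hleft _ fun i j hij => Matrix.diagonal_apply_ne _ hij.ne, hright, minorPower_diagonal,
      hs, hs] at this
  obtain ⟨m, hm⟩ := Nat.exists_eq_add_of_lt hk
  have hT'c : Continuous T' := by
    refine continuous_matrix fun i j => ?_
    simp only [T', Matrix.of_apply]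
    split_ifs <;> fun_prop
  have hlim := Continuous.ext_on (dense_compl_singleton (0 : ℂ))
    (f := fun _ => J T) (g := fun t => J (T' t) * t ^ (m + 1)) continuous_const
    ((hJc.comp hT'c).mul (continuous_pow _)) fun t ht => by
      have ht' : t ≠ 0 := ht
      refine mul_left_cancel₀ (pow_ne_zero (∑ i with i ≤ k, minorWeight c i) ht') ?_
      beta_reduce
      rw [hscale, hm]
      ring
  simpa using congrFun hlim 0

theorem integral_prod_symPowerEntry_eq_zero (β : Fin N → Fin N →₀ ℕ) (c : Fin N → ℕ) {k : Fin N}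
    (hk : ∑ i with i ≤ k, minorWeight c i < ∑ i with i ≤ k, ∑ j, β i j) :
    ∫ U : Matrix.unitaryGroup (Fin N) ℂ,
      (∏ i, symPowerEntry (U : Matrix (Fin N) (Fin N) ℂ)ᴴ (β i) (β i)) *
        minorPower c (U : Matrix (Fin N) (Fin N) ℂ) ∂μ = 0 := by
  classical
  let I : (Fin N → Fin N →₀ ℕ) → ℂ := fun γ => ∫ U : Matrix.unitaryGroup (Fin N) ℂ,
      (∏ i, symPowerEntry (U : Matrix (Fin N) (Fin N) ℂ)ᴴ (β i) (γ i)) *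
        minorPower c (U : Matrix (Fin N) (Fin N) ℂ) ∂μ
  let e : (Fin N → Fin N →₀ ℕ) → (Fin N × Fin N →₀ ℕ) := fun γ =>
    Finsupp.equivFunOnFinite.symm fun p => γ p.2 p.1
  have he : Function.Injective e := by
    intro γ δ h
    funext i
    ext j
    exact congrFun (Finsupp.equivFunOnFinite.symm.injective h) (j, i)
  let P : MvPolynomial (Fin N × Fin N) ℂ :=
    ∑ γ ∈ Fintype.piFinset fun i => monomialsOfDegree N (∑ j, β i j),
      MvPolynomial.monomial (e γ) (I γ)
  have hcont : ∀ γ : Fin N → Fin N →₀ ℕ, Continuous fun U : Matrix.unitaryGroup (Fin N) ℂ =>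
      (∏ i, symPowerEntry (U : Matrix (Fin N) (Fin N) ℂ)ᴴ (β i) (γ i)) *
        minorPower c (U : Matrix (Fin N) (Fin N) ℂ) := fun γ =>
    (continuous_finsetProd _ fun i _ => (isPolyFunction_symPowerEntry (β i) (γ i)).continuous.comp
      continuous_conjTranspose_unitary).mul
      ((isPolyFunction_minorPower c).continuous.comp continuous_coe_unitary)
  have hP : P = 0 := by
    refine MvPolynomial.funext fun x => ?_
    rw [map_zero, ← integral_columnMonomial_eq_zero (μ := μ) β c hk
      (Matrix.of fun i j => x (i, j))]
    simp only [columnMonomial_mul_eq_sum, Finset.sum_mul]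
    rw [integral_finsetSum]
    · simp only [P, map_sum, MvPolynomial.eval_monomial]
      refine Finset.sum_congr rfl fun γ _ => ?_
      simp only [I, mul_right_comm _ (∏ i, ∏ j, _)]
      rw [integral_mul_const, Finsupp.prod_fintype _ _ (by simp), Fintype.prod_prod_type,
        Finset.prod_comm]
      rfl
    · intro γ _
      simp only [mul_right_comm _ (∏ i, ∏ j, _)]
      exact (integrable_of_continuous (hcont γ)).mul_const _
  have h := congrArg (MvPolynomial.coeff (e β)) hP
  rw [MvPolynomial.coeff_sum, Finset.sum_eq_single β] at h
  · simpa using h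
  · intro γ _ hγ
    rw [MvPolynomial.coeff_monomial, if_neg fun h => hγ (he h)]
  · intro hβ
    exact absurd (Fintype.mem_piFinset.mpr fun i => mem_monomialsOfDegree.mpr rfl) hβ

theorem integral_prod_completeSeries_eq_zero (α c : Fin N → ℕ) {k : Fin N}
    (hk : ∑ i with i ≤ k, minorWeight c i < ∑ i with i ≤ k, α i) :
    ∫ U : Matrix.unitaryGroup (Fin N) ℂ,
      (∏ i, PowerSeries.coeff (α i)
        (completeSeries (U : Matrix (Fin N) (Fin N) ℂ)ᴴ.charpoly.roots)) *
        minorPower c (U : Matrix (Fin N) (Fin N) ℂ) ∂μ = 0 := by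
  simp only [coeff_completeSeries_eq_trace, Finset.prod_univ_sum, Finset.sum_mul]
  rw [integral_finsetSum]
  · refine Finset.sum_eq_zero fun β hβ => integral_prod_symPowerEntry_eq_zero β c (k := k) ?_
    rw [Fintype.mem_piFinset] at hβ
    simpa only [mem_monomialsOfDegree.mp (hβ _)] using hk
  · intro β _
    exact integrable_of_continuous ((continuous_finsetProd _ fun i _ =>
      (isPolyFunction_symPowerEntry (β i) (β i)).continuous.comp
      continuous_conjTranspose_unitary).mul
      ((isPolyFunction_minorPower c).continuous.comp continuous_coe_unitary))

/-- A Schur polynomial is orthogonal to the highest weight functions whose weight does not dominate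
its index: every term `∏ h_{κ_i - i + σ(i)}` of the Jacobi–Trudi determinant has an index that
dominates `κ`. -/
theorem integral_det_jacobiTrudi_mul_minorPower_eq_zero (κ c : Fin N → ℕ) {k : Fin N}
    (hk : ∑ i with i ≤ k, minorWeight c i < ∑ i with i ≤ k, κ i) :
    ∫ U : Matrix.unitaryGroup (Fin N) ℂ,
      (jacobiTrudi κ fun m => PowerSeries.coeff m
        (completeSeries (U : Matrix (Fin N) (Fin N) ℂ)ᴴ.charpoly.roots)).det *
        minorPower c (U : Matrix (Fin N) (Fin N) ℂ) ∂μ = 0 := by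
  simp only [← Matrix.det_transpose (jacobiTrudi κ _), Matrix.det_apply', Finset.sum_mul,
    Matrix.transpose_apply, mul_assoc]
  have hterm : ∀ (σ : Equiv.Perm (Fin N)) (g : ℕ → ℂ), ∏ i, jacobiTrudi κ g i (σ i) =
      if ∀ i : Fin N, (i : ℕ) ≤ κ i + σ i then ∏ i, g (κ i + σ i - i) else 0 := by
    intro σ g
    split_ifs with h
    · simp [jacobiTrudi, h]
    · push Not at h
      obtain ⟨i, hi⟩ := h
      exact Finset.prod_eq_zero (Finset.mem_univ i) (by simp [jacobiTrudi, hi])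
  simp only [hterm]
  have hcont : ∀ σ : Equiv.Perm (Fin N), Continuous fun U : Matrix.unitaryGroup (Fin N) ℂ =>
      (∏ i, PowerSeries.coeff (κ i + σ i - i)
        (completeSeries (U : Matrix (Fin N) (Fin N) ℂ)ᴴ.charpoly.roots)) *
        minorPower c (U : Matrix (Fin N) (Fin N) ℂ) := fun σ =>
    (continuous_finsetProd _ fun i _ => continuous_coeff_completeSeries _).mul
      ((isPolyFunction_minorPower c).continuous.comp continuous_coe_unitary)
  rw [integral_finsetSum]
  · refine Finset.sum_eq_zero fun σ _ => ?_
    rw [integral_const_mul]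
    split_ifs with h
    · rw [integral_prod_completeSeries_eq_zero (fun i => κ i + σ i - i) c (k := k), mul_zero]
      refine hk.trans_le ?_
      have h1 : ∑ i with i ≤ k, (κ i + σ i - i) + ∑ i with i ≤ k, (i : ℕ) =
          ∑ i with i ≤ k, κ i + ∑ i with i ≤ k, (σ i : ℕ) := by
        rw [← Finset.sum_add_distrib, ← Finset.sum_add_distrib]
        exact Finset.sum_congr rfl fun i _ => Nat.sub_add_cancel (h i)
      have h2 := sum_le_sum_perm σ k
      omega
    · simp
  · intro σ _
    refine Integrable.const_mul ?_ _
    split_ifs with h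
    · exact integrable_of_continuous (hcont σ)
    · simp

end Dominance

/-! ### Schur polynomials are multiples of spherical functions -/

section Identification

open scoped MonomialOrder

variable {N : ℕ}

theorem antitone_rowLen (lam : YoungDiagram) : Antitone fun i : Fin N => lam.rowLen i :=
  fun _ _ hij => lam.rowLen_anti _ _ hij

theorem matrixSchur_conj_diagonal {lam : YoungDiagram} (hlam : lam.colLen 0 ≤ N)
    (U : Matrix.unitaryGroup (Fin N) ℂ) (d : Fin N → ℂ) :
    matrixSchur lam ((U : Matrix (Fin N) (Fin N) ℂ) * Matrix.diagonal d * (U : Matrix (Fin N) (Fin N) ℂ)ᴴ) =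
      MvPolynomial.eval d (jacobiTrudi (fun i : Fin N => lam.rowLen i)
        (MvPolynomial.hsymm (Fin N) ℂ)).det := by
  rw [matrixSchur_eq_det hlam, charpoly_conj_diagonal, roots_charpoly_diagonal,
    eval_det_jacobiTrudi]
  simp only [eval_hsymm]

variable [MeasurableSpace (Matrix.unitaryGroup (Fin N) ℂ)]
  [BorelSpace (Matrix.unitaryGroup (Fin N) ℂ)]
  {μ : Measure (Matrix.unitaryGroup (Fin N) ℂ)} [μ.IsHaarMeasure] [IsProbabilityMeasure μ]

/-- An expansion of a Schur polynomial in spherical polynomials gives the same expansion for the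
functions on matrices. -/
theorem matrixSchur_eq_sum {lam : YoungDiagram} (hlam : lam.colLen 0 ≤ N)
    {b : (Fin N → ℕ) →₀ ℂ} (hb : (b.sum fun a r => r • sphericalPolynomial μ a) =
      (jacobiTrudi (fun i : Fin N => lam.rowLen i) (MvPolynomial.hsymm (Fin N) ℂ)).det)
    (X : Matrix (Fin N) (Fin N) ℂ) :
    matrixSchur lam X = ∑ a ∈ b.support, b a * sphericalFunction μ a X := by
  refine congrFun (IsPolyFunction.ext_conj_diagonal (isPolyFunction_matrixSchur hlam)
    (g := fun X => ∑ a ∈ b.support, b a * sphericalFunction μ a X) ?_ fun U d => ?_) X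
  · choose P hP using fun a : Fin N → ℕ => isPolyFunction_sphericalFunction (μ := μ) a
    exact ⟨∑ a ∈ b.support, MvPolynomial.C (b a) * P a, fun X => by simp [hP]⟩
  · rw [matrixSchur_conj_diagonal hlam, ← hb, Finsupp.sum, map_sum]
    refine Finset.sum_congr rfl fun a _ => ?_
    rw [MvPolynomial.smul_eval, eval_sphericalPolynomial, sphericalFunction_mul_comm,
      ← Matrix.mul_assoc, conjTranspose_mul_self_unitary, Matrix.one_mul]

/-- Only weights dominating the partition occur in the expansion of a Schur polynomial. -/
theorem lex_le_of_coeff_ne_zero {lam : YoungDiagram} (hlam : lam.colLen 0 ≤ N)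
    {b : (Fin N → ℕ) →₀ ℂ} (hb : (b.sum fun a r => r • sphericalPolynomial μ a) =
      (jacobiTrudi (fun i : Fin N => lam.rowLen i) (MvPolynomial.hsymm (Fin N) ℂ)).det)
    {c : Fin N → ℕ} (hc : b c ≠ 0) :
    (Finsupp.equivFunOnFinite.symm fun i : Fin N => lam.rowLen i) ≼[MonomialOrder.lex]
      Finsupp.equivFunOnFinite.symm (minorWeight c) := by
  refine lex_le_of_sum_le fun k => ?_
  by_contra! hk
  have h := integral_det_jacobiTrudi_mul_minorPower_eq_zero (μ := μ)
    (fun i : Fin N => lam.rowLen i) c hk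
  simp only [← matrixSchur_eq_det hlam, matrixSchur_eq_sum hlam hb, Finset.sum_mul,
    mul_assoc] at h
  rw [integral_finsetSum] at h
  · rw [Finset.sum_eq_single c] at h
    · rw [integral_const_mul] at h
      exact mul_ne_zero hc (integral_sphericalFunction_mul_minorPower_self_ne_zero c) h
    · intro a _ hac
      rw [integral_const_mul, integral_sphericalFunction_mul_minorPower_of_ne hac, mul_zero]
    · intro hc'
      exact absurd (Finsupp.mem_support_iff.mpr hc) hc'
  · intro a _
    exact (integrable_of_continuous (((isPolyFunction_sphericalFunction a).continuous.comp
      continuous_conjTranspose_unitary).mul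
      ((isPolyFunction_minorPower c).continuous.comp continuous_coe_unitary))).const_mul _

/-- The largest weight in the expansion of a Schur polynomial is the exponent of its leading
monomial, so the partition itself is the only weight that occurs. -/
theorem exists_matrixSchur_eq {lam : YoungDiagram} (hlam : lam.colLen 0 ≤ N) :
    ∃ a : Fin N → ℕ, matrixSchur lam (1 : Matrix (Fin N) (Fin N) ℂ) ≠ 0 ∧
      ∀ X : Matrix (Fin N) (Fin N) ℂ, matrixSchur lam X =
        matrixSchur lam (1 : Matrix (Fin N) (Fin N) ℂ) * sphericalFunction μ a X := by
  obtain ⟨a, ha⟩ := exists_minorWeight_eq (antitone_rowLen (N := N) lam)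
  obtain ⟨hs0, hdeg⟩ := degree_det_jacobiTrudi (antitone_rowLen (N := N) lam)
  obtain ⟨b, hb⟩ := Finsupp.mem_span_range_iff_exists_finsupp.mp
    (mem_span_sphericalPolynomial (μ := μ)
      (isSymmetric_det_jacobiTrudi fun i : Fin N => lam.rowLen i))
  let w : (Fin N → ℕ) → (MonomialOrder.lex (σ := Fin N)).syn := fun c =>
    MonomialOrder.lex.toSyn (Finsupp.equivFunOnFinite.symm (minorWeight c))
  have hw : Function.Injective w := fun c c' h => minorWeight_injective
    (Finsupp.equivFunOnFinite.symm.injective (MonomialOrder.lex.toSyn.injective h))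
  have hne : b.support.Nonempty := by
    rw [Finsupp.support_nonempty_iff]
    rintro rfl
    exact hs0 (by rw [← hb, Finsupp.sum_zero_index])
  obtain ⟨m, hm, hmax⟩ := b.support.exists_max_image w hne
  have hcoeff : (jacobiTrudi (fun i : Fin N => lam.rowLen i)
      (MvPolynomial.hsymm (Fin N) ℂ)).det.coeff
        (Finsupp.equivFunOnFinite.symm (minorWeight m)) ≠ 0 := by
    rw [← hb, Finsupp.sum, MvPolynomial.coeff_sum, Finset.sum_eq_single m]
    · rw [MvPolynomial.coeff_smul, smul_eq_mul]
      exact mul_ne_zero (Finsupp.mem_support_iff.mp hm) (coeff_sphericalPolynomial_ne_zero m)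
    · intro c hc hcm
      rw [MvPolynomial.coeff_smul, MonomialOrder.coeff_eq_zero_of_lt (m := MonomialOrder.lex),
        smul_zero]
      rw [degree_sphericalPolynomial]
      exact lt_of_le_of_ne (hmax c hc) (hw.ne hcm)
    · exact fun h => absurd hm h
  have hle := MonomialOrder.lex.le_degree (MvPolynomial.mem_support_iff.mpr hcoeff)
  rw [hdeg, ← ha] at hle
  have huniq : ∀ c ∈ b.support, c = a := fun c hc => hw (le_antisymm ((hmax c hc).trans hle) (by
    have := lex_le_of_coeff_ne_zero hlam hb (Finsupp.mem_support_iff.mp hc)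
    rwa [← ha] at this))
  have hba : b a ≠ 0 := by
    rw [← huniq m hm]
    exact Finsupp.mem_support_iff.mp hm
  have hX : ∀ X : Matrix (Fin N) (Fin N) ℂ, matrixSchur lam X = b a * sphericalFunction μ a X := by
    intro X
    rw [matrixSchur_eq_sum hlam hb]
    exact Finset.sum_eq_single a (fun c hc hca => absurd (huniq c hc) hca)
      fun h => absurd (Finsupp.mem_support_iff.mpr hba) h
  have h1 : matrixSchur lam (1 : Matrix (Fin N) (Fin N) ℂ) = b a := by
    rw [hX, sphericalFunction_one, mul_one]
  exact ⟨a, h1 ▸ hba, fun X => by rw [h1, hX]⟩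

end Identification

theorem proposition1 (N : ℕ)
    [MeasurableSpace (Matrix.unitaryGroup (Fin N) ℂ)] [BorelSpace (Matrix.unitaryGroup (Fin N) ℂ)]
    (μ : Measure (Matrix.unitaryGroup (Fin N) ℂ)) [μ.IsHaarMeasure] [IsProbabilityMeasure μ]
    (lam : YoungDiagram) (hlam : lam.colLen 0 ≤ N)
    (A B : Matrix (Fin N) (Fin N) ℂ) :
    matrixSchur lam (1 : Matrix (Fin N) (Fin N) ℂ) ≠ 0 ∧
    Integrable (fun U : Matrix.unitaryGroup (Fin N) ℂ =>
      matrixSchur lam ((U : Matrix (Fin N) (Fin N) ℂ) * A *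
        (U : Matrix (Fin N) (Fin N) ℂ)ᴴ * B)) μ ∧
    ∫ U : Matrix.unitaryGroup (Fin N) ℂ,
      matrixSchur lam ((U : Matrix (Fin N) (Fin N) ℂ) * A *
        (U : Matrix (Fin N) (Fin N) ℂ)ᴴ * B) ∂μ =
      matrixSchur lam A * matrixSchur lam B /
        matrixSchur lam (1 : Matrix (Fin N) (Fin N) ℂ) := by
  obtain ⟨a, h1, hX⟩ := exists_matrixSchur_eq (μ := μ) hlam
  refine ⟨h1, ?_, ?_⟩
  · exact integrable_of_continuous ((isPolyFunction_matrixSchur hlam).continuous.comp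
      (((continuous_coe_unitary.matrix_mul continuous_const).matrix_mul
        continuous_conjTranspose_unitary).matrix_mul continuous_const))
  · simp only [hX (_ * B)]
    rw [integral_const_mul, integral_sphericalFunction_conj_mul, hX A, hX B]
    field_simp
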